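/- Let $\alpha\in(1,2)$ and let $(\Omega,\mathcal F,P)$ be a probability space. Random measure. Let $M$ be an independently scattered rotationally invariant complex symmetric $\alpha$-stable random measure on $\mathbb R$ with Lebesgue control measure $\lambda$ and Hermitian symmetry, that is, a family of complex random variables $M(A)$, indexed by the Borel sets $A\subset\mathbb R$ of finite Lebesgue measure, such that: (a) if $A_1,A_2,\dots$ are disjoint and $\lambda(\bigcup_i A_i)<\infty$, then $\sum_{i=1}^N M(A_i)\to M(\bigcup_i A_i)$ almost surely as $N\to\infty$; (b) for $A\subset[0,\infty)$ and $\theta\in\mathbb R$, $e^{i\theta}M(A)$ has the same law as $M(A)$, and $E\,e^{is\,\mathrm{Re}\,M(A)}=e^{-\lambda(A)|s|^\alpha}$ for all $s\in\mathbb R$; (c) $M(A_1),\dots,M(A_n)$ are independent for disjoint $A_1,\dots,A_n\subset[0,\infty)$; (d) $M(-A)=\overline{M(A)}$ almost surely. For $f\in L^\alpha(\mathbb R;\mathbb C)$ with $f(-x)=\overline{f(x)}$, the real random variable $\int_{\mathbb R}f(x)\,M(dx)$ is the limit in probability of $\int\varphi_n\,dM$, where $\varphi_n$ are simple functions with supports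 of finite measure and the same symmetry, $\varphi_n\to f$ in $L^\alpha(\mathbb R)$, and $\int\sum_j c_j\mathbf 1_{A_j}\,dM=\sum_j c_jM(A_j)$. Process. Let $H:[0,\infty)\to\mathbb R$ satisfy $0<\inf_t H(t)\le\sup_t H(t)<1$, and suppose that there are $\gamma>\sup_t H(t)$ and $K$ with $|H(t)-H(s)|\le K|t-s|^\gamma$ for all $s,t\ge0$. Let $X$ be the real harmonizable multifractional stable process with Hurst function $H$, $$X(t)=\int_{\mathbb R}\frac{e^{itx}-1}{|x|^{1/\alpha+H(t)}}\,M(dx),\qquad t\ge0 .$$ For a real symmetric $\alpha$-stable random variable $\xi$ put $\|\xi\|_\alpha=(-\log E\,e^{i\xi})^{1/\alpha}$, and for a real linear space $V$ of such variables put $\|\xi-V\|_\alpha=\inf_{\eta\in V}\|\xi-\eta\|_\alpha$. Theorem. For every $T$ and every $\varepsilon>0$ the process $X$ is $\|\cdot\|_\alpha$ locally nondeterministic on $[\varepsilon,T]$, that is: (L1) $\|X(t)\|_\alpha>0$ for all $t\in[\varepsilon,T]$; (L2) there is $\delta>0$ such that $\|X(t)-X(s)\|_\alpha>0$ for all $s\ne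 t$ in $[\varepsilon,T]$ with $|t-s|<\delta$; (L3) for every integer $n>1$ there are $C_n>0$ and $\delta_n>0$ such that for all $t_1<t_2<\dots<t_n$ in $[\varepsilon,T]$ with $t_n-t_1<\delta_n$, $$\big\|X(t_n)-\mathrm{span}_{\mathbb R}\{X(t_1),\dots,X(t_{n-1})\}\big\|_\alpha\ \ge\ C_n\,\|X(t_n)-X(t_{n-1})\|_\alpha .$$ -/

import Mathlib

open MeasureTheory ProbabilityTheory Filter Topology Set

noncomputable section

/-- `M` is an independently scattered, rotationally invariant complex symmetric `α`-stable random
measure on `ℝ` with Lebesgue control measure and with the Hermitian symmetry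
`M(-A) = conj M(A)`, on the probability space `(Ω, P)`. The random variable `M A` is meaningful for
Borel sets `A` of finite Lebesgue measure.

In view of the Hermitian symmetry (which makes `M A` real when `A = -A`), rotational invariance,
the scale and independence are conditions on Borel subsets of the half-line `[0, ∞)`.

Countable additivity is almost sure convergence of the partial sums. (The series need not converge
absolutely, so `HasSum` would be the wrong notion.) -/
structure IsHermitianStableMeasure {Ω : Type*} [MeasurableSpace Ω] (α : ℝ) (P : Measure Ω)
    (M : Set ℝ → Ω → ℂ) : Prop where
  measurable : ∀ A : Set ℝ, MeasurableSet A → volume A < ⊤ → Measurable (M A)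
  /-- Countable additivity. -/
  sigmaAdditive : ∀ A : ℕ → Set ℝ, (∀ i, MeasurableSet (A i)) →
    Pairwise (fun i j => Disjoint (A i) (A j)) → volume (⋃ i, A i) < ⊤ →
    ∀ᵐ ω ∂P, Tendsto (fun N : ℕ => ∑ i ∈ Finset.range N, M (A i) ω) atTop (𝓝 (M (⋃ i, A i) ω))
  /-- Rotational invariance: `e^{iθ} M(A)` has the law of `M(A)`. -/
  rotation : ∀ A : Set ℝ, MeasurableSet A → volume A < ⊤ → A ⊆ Ici 0 → ∀ θ : ℝ,
    IdentDistrib (fun ω => Complex.exp (Complex.I * (θ : ℂ)) * M A ω) (M A) P P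
  /-- `Re M(A)` has characteristic function `s ↦ exp (-λ(A) |s|^α)`. -/
  scale : ∀ A : Set ℝ, MeasurableSet A → volume A < ⊤ → A ⊆ Ici 0 → ∀ s : ℝ,
    ∫ ω, Complex.exp (Complex.I * ((s * (M A ω).re : ℝ) : ℂ)) ∂P
      = ((Real.exp (-((volume A).toReal * |s| ^ α)) : ℝ) : ℂ)
  /-- Independent scattering. -/
  indep : ∀ (n : ℕ) (A : Fin n → Set ℝ), (∀ i, MeasurableSet (A i)) → (∀ i, volume (A i) < ⊤) →
    (∀ i, A i ⊆ Ici 0) → Pairwise (fun i j => Disjoint (A i) (A j)) →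
    iIndepFun (fun i => M (A i)) P
  /-- `M(-A) = conj M(A)` almost surely. -/
  hermitian : ∀ A : Set ℝ, MeasurableSet A → volume A < ⊤ →
    ∀ᵐ ω ∂P, M ((fun x : ℝ => -x) ⁻¹' A) ω = (starRingEnd ℂ) (M A ω)

/-- The integral `∑ c, c * M {φ = c}` of a simple function against a random measure. (The value
`c = 0` contributes `0`.) -/
def simpleStochIntegral {Ω : Type*} (M : Set ℝ → Ω → ℂ) (φ : SimpleFunc ℝ ℂ) (ω : Ω) : ℂ :=
  ∑ c ∈ φ.range, c * M (φ ⁻¹' {c}) ω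

/-- `ξ` is (a version of) the stochastic integral `∫ f(x) M(dx)`, for `f : ℝ → ℂ` with
`f (-x) = conj (f x)`: there are simple functions `φ n` with the same symmetry and supports of
finite measure, which converge to `f` in `L^α(ℝ)` and whose integrals converge to `ξ` in
probability. -/
def IsStochIntegral {Ω : Type*} [MeasurableSpace Ω] (α : ℝ) (P : Measure Ω)
    (M : Set ℝ → Ω → ℂ) (f : ℝ → ℂ) (ξ : Ω → ℝ) : Prop :=
  ∃ φ : ℕ → SimpleFunc ℝ ℂ,
    (∀ n x, φ n (-x) = (starRingEnd ℂ) (φ n x)) ∧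
    (∀ n, (φ n).FinMeasSupp volume) ∧
    Tendsto (fun n => eLpNorm (fun x => f x - φ n x) (ENNReal.ofReal α) volume) atTop (𝓝 0) ∧
    TendstoInMeasure P (fun n ω => simpleStochIntegral M (φ n) ω) atTop (fun ω => (ξ ω : ℂ))

/-- The kernel `(e^{itx} - 1) / |x|^{1/α + h}`. -/
def harmonizableKernel (α h t x : ℝ) : ℂ :=
  (Complex.exp (Complex.I * ((t * x : ℝ) : ℂ)) - 1) / ((|x| ^ (1 / α + h) : ℝ) : ℂ)

/-- `X(t)`, `t ≥ 0`, is the real harmonizable multifractional stable process with Hurst function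
`H` and stability parameter `α`, built from the random measure `M`:
`X(t) = ∫ (e^{itx} - 1) / |x|^{1/α + H(t)} M(dx)`. -/
def IsRHMSP {Ω : Type*} [MeasurableSpace Ω] (α : ℝ) (H : ℝ → ℝ) (P : Measure Ω)
    (M : Set ℝ → Ω → ℂ) (X : ℝ → Ω → ℝ) : Prop :=
  ∀ t : ℝ, 0 ≤ t → IsStochIntegral α P M (harmonizableKernel α (H t) t) (X t)

/-- `‖ξ‖_α = (-log E e^{iξ})^{1/α}` for a real symmetric `α`-stable random variable `ξ`
(whose characteristic function is real and positive). -/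
def stableNorm {Ω : Type*} [MeasurableSpace Ω] (α : ℝ) (P : Measure Ω) (ξ : Ω → ℝ) : ℝ :=
  (-Real.log (∫ ω, Complex.exp (Complex.I * (ξ ω : ℂ)) ∂P).re) ^ (1 / α)

/-- The distance `‖ξ - V‖_α = inf_{η ∈ V} ‖ξ - η‖_α` to a linear space `V` of random variables. -/
def stableDist {Ω : Type*} [MeasurableSpace Ω] (α : ℝ) (P : Measure Ω) (ξ : Ω → ℝ)
    (V : Submodule ℝ (Ω → ℝ)) : ℝ :=
  ⨅ η : V, stableNorm α P (ξ - (η : Ω → ℝ))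

/-- `‖·‖_α` local nondeterminism of the stable process `X` on the set `S` of times. -/
structure IsLND {Ω : Type*} [MeasurableSpace Ω] (α : ℝ) (P : Measure Ω) (X : ℝ → Ω → ℝ)
    (S : Set ℝ) : Prop where
  L1 : ∀ t ∈ S, 0 < stableNorm α P (X t)
  L2 : ∃ δ : ℝ, 0 < δ ∧ ∀ s ∈ S, ∀ t ∈ S, s ≠ t → |t - s| < δ →
    0 < stableNorm α P (X t - X s)
  /-- The points are `t 0 < ⋯ < t (n + 1)`, so that there are `n + 2 ≥ 2` of them; the last two are
  `t (Fin.last n).castSucc` and `t (Fin.last (n + 1))`. -/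
  L3 : ∀ n : ℕ, ∃ C : ℝ, 0 < C ∧ ∃ δ : ℝ, 0 < δ ∧
    ∀ t : Fin (n + 2) → ℝ, StrictMono t → (∀ i, t i ∈ S) → t (Fin.last (n + 1)) - t 0 < δ →
      C * stableNorm α P (X (t (Fin.last (n + 1))) - X (t (Fin.last n).castSucc)) ≤
        stableDist α P (X (t (Fin.last (n + 1))))
          (Submodule.span ℝ (Set.range fun k : Fin (n + 1) => X (t k.castSucc)))

end

/-! By Hermitian symmetry the integral of `f` is twice the real part of an integral over the
positive half-line. Rotational invariance and independence then show that its stable norm is twice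
the norm of `f` in $L^\alpha(0,\infty)$ (`IsAEStochIntegral.stableNorm_eq`), so everything becomes a
statement about kernels. With $\tau=t_n$ and $r=t_n-t_{n-1}$, two estimates suffice. The kernel of
$\tau$ has distance at least $c\,r^{H(\tau)}$ from the span of kernels of times at most $\tau-r$
(`exists_mul_rpow_le_eLpNorm_kernel`). The increment has norm at most
$C(r^{H(\tau)}+|H(\tau)-H(t_{n-1})|)$ (`exists_eLpNorm_kernel_sub_le`), whose second term is
absorbed because $\gamma>\sup H$.

For the lower bound, integrate the kernels against $x e^{-wx}$ with $\mathrm{Re}\,w>0$. The kernel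
of time $t$ and exponent $h$ gives $\Gamma(\nu)((w-it)^{-\nu}-w^{-\nu})$, $\nu=2-1/\alpha-h$, which
is singular only at $it$ and $0$. Put $w=i\tau+r\zeta$. The kernel of $\tau$ contributes a multiple
of $\zeta^{-\nu}$. All other singularities are at distance at least $r$ from $i\tau$, so the
remaining terms form a function $F$ that is regular in $|\zeta|<1$. By Hölder's inequality a
combination with small $L^\alpha$ norm makes $F$ nearly cancel $\zeta^{-\nu}$ in the right half of
the disc.

This is impossible by a Remez-type inequality (`hasRemezBound`): a bound for $F$ on a small disc
yields a bound on $|\zeta|\le 1/2$, with a constant that does not depend on the coefficients or the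
positions of the singularities. As $F$ is bounded near $1/4$, it is bounded near $0$, where
$\zeta^{-\nu}$ is not. The inequality is proved as in Rolle's argument: dividing by one product of
powers and differentiating lowers the degree of its polynomial factor without adding terms. -/

noncomputable section

/-! ### Finite additivity of the random measure and linearity of the simple integral -/

namespace IsHermitianStableMeasure

variable {Ω : Type*} [MeasurableSpace Ω] {P : Measure Ω} {α : ℝ} {M : Set ℝ → Ω → ℂ}

/-- For the constant sequence `∅` the partial sums are the multiples of `M ∅`. They converge, so
their consecutive differences `M ∅` tend to zero. -/
lemma ae_empty (hM : IsHermitianStableMeasure α P M) : ∀ᵐ ω ∂P, M ∅ ω = 0 := by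
  filter_upwards [hM.sigmaAdditive (fun _ => ∅) (fun _ => MeasurableSet.empty)
    (fun _ _ _ => disjoint_bot_left) (by simp)] with ω hω
  simp only [Finset.sum_const, Finset.card_range, iUnion_empty] at hω
  have h1 := (hω.comp (tendsto_add_atTop_nat 1)).sub hω
  have h2 : ∀ n : ℕ, (n + 1) • M ∅ ω - n • M ∅ ω = M ∅ ω := fun n => by
    rw [add_smul, one_smul, add_sub_cancel_left]
  simp only [Function.comp_def, h2, sub_self] at h1
  exact tendsto_nhds_unique tendsto_const_nhds h1

lemma ae_union (hM : IsHermitianStableMeasure α P M) {A B : Set ℝ} (hA : MeasurableSet A)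
    (hB : MeasurableSet B) (hA' : volume A < ⊤) (hB' : volume B < ⊤) (hAB : Disjoint A B) :
    ∀ᵐ ω ∂P, M (A ∪ B) ω = M A ω + M B ω := by
  let S : ℕ → Set ℝ := fun n => if n = 0 then A else if n = 1 then B else ∅
  have hU : ⋃ n, S n = A ∪ B := by
    ext x
    simp only [mem_iUnion, mem_union]
    constructor
    · rintro ⟨n, hn⟩
      simp only [S] at hn
      split_ifs at hn
      · exact Or.inl hn
      · exact Or.inr hn
      · exact hn.elim
    · rintro (h | h)
      · exact ⟨0, by simpa [S] using h⟩
      · exact ⟨1, by simpa [S] using h⟩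
  have hS := hM.sigmaAdditive S (fun i => by
      simp only [S]; split_ifs <;> simp [hA, hB]) (fun i j hij => by
      simp only [S]
      split_ifs <;> first | omega | exact hAB | exact hAB.symm | simp)
    (by rw [hU]; exact (measure_union_le _ _).trans_lt (ENNReal.add_lt_top.2 ⟨hA', hB'⟩))
  rw [hU] at hS
  filter_upwards [hS, hM.ae_empty] with ω hω h0
  refine (tendsto_nhds_unique (tendsto_const_nhds.congr' ?_) hω).symm
  filter_upwards [eventually_ge_atTop 2] with N hN
  have h1 : ∀ n, 2 ≤ n → ∑ i ∈ Finset.range n, M (S i) ω = M A ω + M B ω := by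
    intro n hn
    induction n, hn using Nat.le_induction with
    | base => simp [Finset.sum_range_succ, S]
    | succ n hn ih =>
      rw [Finset.sum_range_succ, ih]
      have : S n = ∅ := by
        simp only [S]
        rw [if_neg (by omega), if_neg (by omega)]
      rw [this, h0, add_zero]
  exact (h1 N hN).symm

lemma ae_biUnion (hM : IsHermitianStableMeasure α P M) {ι : Type*} (s : Finset ι) (A : ι → Set ℝ)
    (hA : ∀ i ∈ s, MeasurableSet (A i)) (hA' : ∀ i ∈ s, volume (A i) < ⊤)
    (hd : (s : Set ι).PairwiseDisjoint A) :
    ∀ᵐ ω ∂P, M (⋃ i ∈ s, A i) ω = ∑ i ∈ s, M (A i) ω := by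
  classical
  induction s using Finset.induction_on with
  | empty => simpa using hM.ae_empty
  | insert a s ha ih =>
    have h1 := ih (fun i hi => hA i (Finset.mem_insert_of_mem hi))
      (fun i hi => hA' i (Finset.mem_insert_of_mem hi))
      (hd.subset (by simp))
    have h2 := hM.ae_union (hA a (Finset.mem_insert_self _ _))
      (s.measurableSet_biUnion fun i hi => hA i (Finset.mem_insert_of_mem hi))
      (hA' a (Finset.mem_insert_self _ _))
      ((measure_biUnion_finset_le s A).trans_lt
        (ENNReal.sum_lt_top.2 fun i hi => hA' i (Finset.mem_insert_of_mem hi)))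
      (by
        rw [disjoint_iUnion₂_right]
        intro i hi
        refine hd (by simp) (by simp [hi]) ?_
        rintro rfl
        exact ha hi)
    filter_upwards [h1, h2] with ω h1 h2
    rw [Finset.set_biUnion_insert, h2, h1, Finset.sum_insert ha]

/-- The integral of `g ∘ χ` as a sum over the values of `χ`. -/
lemma simpleStochIntegral_map (hM : IsHermitianStableMeasure α P M) {E : Type*} [Zero E]
    (χ : SimpleFunc ℝ E) (hχ : χ.FinMeasSupp volume) (g : E → ℂ) (hg : g 0 = 0) :
    ∀ᵐ ω ∂P, simpleStochIntegral M (χ.map g) ω = ∑ q ∈ χ.range, g q * M (χ ⁻¹' {q}) ω := by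
  classical
  have key : ∀ c ∈ (χ.map g).range, ∀ᵐ ω ∂P, c * M (χ.map g ⁻¹' {c}) ω =
      ∑ q ∈ χ.range with g q = c, g q * M (χ ⁻¹' {q}) ω := by
    intro c _
    -- The fibre over `0` may have infinite measure, where nothing is known about `M`; its
    -- coefficient removes it.
    by_cases hc : c = 0
    · refine .of_forall fun ω => ?_
      rw [hc, zero_mul, Finset.sum_eq_zero]
      intro q hq
      rw [(Finset.mem_filter.1 hq).2, zero_mul]
    · have hU : (χ.map g ⁻¹' {c}) = ⋃ q ∈ χ.range.filter (g · = c), χ ⁻¹' {q} := by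
        rw [SimpleFunc.map_preimage_singleton]
        ext x
        simp
      have := hM.ae_biUnion (χ.range.filter (g · = c)) (fun q => χ ⁻¹' {q})
        (fun q _ => χ.measurableSet_fiber q) (fun q hq => ?_) (fun q _ q' _ h => ?_)
      · filter_upwards [this] with ω hω
        rw [hU, hω, Finset.mul_sum]
        refine Finset.sum_congr rfl fun q hq => ?_
        rw [(Finset.mem_filter.1 hq).2]
      · refine hχ.meas_preimage_singleton_ne_zero fun h => hc ?_
        rw [← (Finset.mem_filter.1 hq).2, h, hg]
      · exact (disjoint_singleton.2 h).preimage _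
  have hall := (ae_ball_iff (χ.map g).range.countable_toSet).2 key
  filter_upwards [hall] with ω hω
  rw [simpleStochIntegral, Finset.sum_congr rfl (fun c hc => hω c hc)]
  rw [SimpleFunc.range_map]
  exact Finset.sum_fiberwise_of_maps_to (fun q hq => Finset.mem_image_of_mem g hq) _

/-- All three integrands are functions of the pair `(φ, ψ)`, so the integrals expand over one common
partition. -/
lemma simpleStochIntegral_add (hM : IsHermitianStableMeasure α P M) {φ ψ : SimpleFunc ℝ ℂ}
    (hφ : φ.FinMeasSupp volume) (hψ : ψ.FinMeasSupp volume) :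
    ∀ᵐ ω ∂P, simpleStochIntegral M (φ + ψ) ω =
      simpleStochIntegral M φ ω + simpleStochIntegral M ψ ω := by
  have hp := hφ.pair hψ
  have h1 := hM.simpleStochIntegral_map (φ.pair ψ) hp (fun q => q.1 + q.2) (by simp)
  have h2 := hM.simpleStochIntegral_map (φ.pair ψ) hp Prod.fst rfl
  have h3 := hM.simpleStochIntegral_map (φ.pair ψ) hp Prod.snd rfl
  rw [SimpleFunc.map_fst_pair] at h2
  rw [SimpleFunc.map_snd_pair] at h3
  filter_upwards [h1, h2, h3] with ω h1 h2 h3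
  rw [SimpleFunc.add_eq_map₂, h1, h2, h3, ← Finset.sum_add_distrib]
  exact Finset.sum_congr rfl fun q _ => add_mul _ _ _

lemma simpleStochIntegral_const_mul (hM : IsHermitianStableMeasure α P M) {φ : SimpleFunc ℝ ℂ}
    (hφ : φ.FinMeasSupp volume) (a : ℂ) :
    ∀ᵐ ω ∂P, simpleStochIntegral M (φ.map (a * ·)) ω = a * simpleStochIntegral M φ ω := by
  filter_upwards [hM.simpleStochIntegral_map φ hφ (a * ·) (by simp)] with ω hω
  rw [hω, simpleStochIntegral, Finset.mul_sum]
  exact Finset.sum_congr rfl fun q _ => mul_assoc _ _ _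

end IsHermitianStableMeasure

/-! ### Characteristic functions of integrals of Hermitian simple functions -/

namespace IsHermitianStableMeasure

variable {Ω : Type*} [MeasurableSpace Ω] {P : Measure Ω} {α : ℝ} {M : Set ℝ → Ω → ℂ}

/-- Rotational invariance absorbs the phase of `c`, and only the modulus remains as the argument of
`scale`. -/
lemma integral_exp_re_mul (hM : IsHermitianStableMeasure α P M) {A : Set ℝ} (hA : MeasurableSet A)
    (hA' : volume A < ⊤) (hA0 : A ⊆ Ici 0) (c : ℂ) :
    ∫ ω, Complex.exp (Complex.I * ((c * M A ω).re : ℝ)) ∂P =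
      ((Real.exp (-((volume A).toReal * ‖c‖ ^ α)) : ℝ) : ℂ) := by
  have h1 : Measurable fun z : ℂ => Complex.exp (Complex.I * ((‖c‖ * z.re : ℝ) : ℂ)) := by fun_prop
  have h2 := ((hM.rotation A hA hA' hA0 c.arg).comp h1).integral_eq
  have h3 := hM.scale A hA hA' hA0 ‖c‖
  rw [abs_norm] at h3
  simp only [Function.comp_def] at h2
  rw [← h3, ← h2]
  refine integral_congr_ae (.of_forall fun ω => ?_)
  simp only
  rw [← Complex.re_ofReal_mul, ← mul_assoc, mul_comm Complex.I (c.arg : ℂ),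
    Complex.norm_mul_exp_arg_mul_I]

lemma ae_re_mul_eq_zero [IsProbabilityMeasure P] (hM : IsHermitianStableMeasure α P M)
    {A : Set ℝ} (hA : MeasurableSet A) (hA' : volume A = 0) (hA0 : A ⊆ Ici 0) (c : ℂ) :
    ∀ᵐ ω ∂P, (c * M A ω).re = 0 := by
  have hlt : volume A < ⊤ := by simp [hA']
  have hm : Measurable fun ω => (c * M A ω).re :=
    Complex.measurable_re.comp ((hM.measurable A hA hlt).const_mul c)
  have hmap : P.map (fun ω => (c * M A ω).re) = Measure.dirac 0 := by
    have := Measure.isProbabilityMeasure_map (μ := P) hm.aemeasurable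
    refine Measure.ext_of_charFun ?_
    ext t
    rw [charFun_apply_real, integral_map hm.aemeasurable (by fun_prop), charFun_dirac]
    have := hM.integral_exp_re_mul hA hlt hA0 (t * c)
    rw [hA'] at this
    simp only [ENNReal.toReal_zero, zero_mul, neg_zero, Real.exp_zero, Complex.ofReal_one] at this
    rw [inner_zero_left, Complex.ofReal_zero, zero_mul, Complex.exp_zero, ← this]
    refine integral_congr_ae (.of_forall fun ω => ?_)
    have hre : ((t : ℂ) * c * M A ω).re = t * (c * M A ω).re := by
      rw [mul_assoc, Complex.re_ofReal_mul]
    simp only [hre]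
    push_cast
    ring_nf
  have h0 : ∀ᵐ y ∂(P.map fun ω => (c * M A ω).re), y = 0 := by
    rw [hmap, ae_dirac_eq]
    simp
  exact ae_of_ae_map hm.aemeasurable h0

lemma ae_eq_zero [IsProbabilityMeasure P] (hM : IsHermitianStableMeasure α P M)
    {A : Set ℝ} (hA : MeasurableSet A) (hA' : volume A = 0) (hA0 : A ⊆ Ici 0) :
    ∀ᵐ ω ∂P, M A ω = 0 := by
  filter_upwards [hM.ae_re_mul_eq_zero hA hA' hA0 1, hM.ae_re_mul_eq_zero hA hA' hA0 Complex.I]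
    with ω h1 h2
  apply Complex.ext
  · simpa using h1
  · simpa using h2

/-- The integral of a Hermitian simple function is twice the real part of the integral over the
positive half-line. -/
lemma simpleStochIntegral_eq_sum_re [IsProbabilityMeasure P] (hM : IsHermitianStableMeasure α P M)
    {φ : SimpleFunc ℝ ℂ} (hφ : φ.FinMeasSupp volume)
    (hsymm : ∀ x, φ (-x) = (starRingEnd ℂ) (φ x)) :
    ∀ᵐ ω ∂P, simpleStochIntegral M φ ω =
      ((∑ c ∈ φ.range.erase 0, ((2 * c) * M (φ ⁻¹' {c} ∩ Ioi 0) ω).re : ℝ) : ℂ) := by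
  have key : ∀ c ∈ φ.range.erase 0, ∀ᵐ ω ∂P, M (φ ⁻¹' {c}) ω =
      M (φ ⁻¹' {c} ∩ Ioi 0) ω +
        (starRingEnd ℂ) (M (φ ⁻¹' {(starRingEnd ℂ) c} ∩ Ioi 0) ω) := by
    intro c hc
    have hc0 := Finset.ne_of_mem_erase hc
    have hm : ∀ z, MeasurableSet (φ ⁻¹' {z}) := fun z => φ.measurableSet_fiber z
    have hv : ∀ z ≠ 0, ∀ S, volume (φ ⁻¹' {z} ∩ S) < ⊤ := fun z hz S =>
      (measure_mono inter_subset_left).trans_lt (hφ.meas_preimage_singleton_ne_zero hz)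
    have hc1 : (starRingEnd ℂ) c ≠ 0 := by simpa using hc0
    have hneg : (fun x : ℝ => -x) ⁻¹' (φ ⁻¹' {(starRingEnd ℂ) c} ∩ Ioi 0) =
        φ ⁻¹' {c} ∩ Iio 0 := by
      ext x
      simp [hsymm, (starRingEnd ℂ).injective.eq_iff]
    have h1 := hM.hermitian (φ ⁻¹' {(starRingEnd ℂ) c} ∩ Ioi 0) ((hm _).inter measurableSet_Ioi)
      (hv _ hc1 _)
    rw [hneg] at h1
    have h2 := hM.ae_union ((hm c).inter measurableSet_Ioi) ((hm c).inter measurableSet_Iio)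
      (hv c hc0 (Ioi 0))
      (hv c hc0 (Iio 0)) (Ioi_disjoint_Iio_same.mono inter_subset_right inter_subset_right)
    rw [← inter_union_distrib_left] at h2
    have h3 := hM.ae_union ((hm c).inter (measurableSet_Ioi.union measurableSet_Iio))
      ((hm c).inter (measurableSet_singleton (0 : ℝ))) (hv c hc0 (Ioi 0 ∪ Iio 0)) (hv c hc0 _)
      (Disjoint.mono inter_subset_right inter_subset_right (by simp))
    have hU : (Ioi (0 : ℝ) ∪ Iio 0) ∪ {0} = univ := by
      ext x
      rcases lt_trichotomy x 0 with h | h | h <;> simp [h, em]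
    rw [← inter_union_distrib_left, hU, inter_univ] at h3
    -- The origin lies in neither open half-line, but it is a null set.
    have h4 := hM.ae_eq_zero ((hm c).inter (measurableSet_singleton (0 : ℝ)))
      (measure_mono_null inter_subset_right (by simp))
      (inter_subset_right.trans (by simp))
    filter_upwards [h1, h2, h3, h4] with ω h1 h2 h3 h4
    rw [h3, h2, h1, h4, add_zero]
  filter_upwards [(ae_ball_iff (φ.range.erase 0).countable_toSet).2 key] with ω hω
  have h0 : simpleStochIntegral M φ ω = ∑ c ∈ φ.range.erase 0, c * M (φ ⁻¹' {c}) ω :=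
    (Finset.sum_erase _ (by simp)).symm
  -- Conjugation permutes the nonzero values of `φ`, so the negative half-line contributes the
  -- conjugate of the positive one.
  have hconj : ∑ c ∈ φ.range.erase 0,
      c * (starRingEnd ℂ) (M (φ ⁻¹' {(starRingEnd ℂ) c} ∩ Ioi 0) ω) =
      ∑ c ∈ φ.range.erase 0, (starRingEnd ℂ) (c * M (φ ⁻¹' {c} ∩ Ioi 0) ω) := by
    have hmem : ∀ c ∈ φ.range.erase 0, (starRingEnd ℂ) c ∈ φ.range.erase 0 := by
      intro c hc
      obtain ⟨hc0, hc⟩ := Finset.mem_erase.1 hc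
      obtain ⟨x, rfl⟩ := SimpleFunc.mem_range.1 hc
      exact Finset.mem_erase.2 ⟨by simpa using hc0, SimpleFunc.mem_range.2 ⟨-x, hsymm x⟩⟩
    refine Finset.sum_bij' (fun c _ => (starRingEnd ℂ) c) (fun c _ => (starRingEnd ℂ) c) hmem hmem
      (by simp) (by simp) (by simp)
  rw [h0, Finset.sum_congr rfl fun c hc => by rw [hω c hc, mul_add], Finset.sum_add_distrib, hconj,
    ← Finset.sum_add_distrib, Complex.ofReal_sum]
  refine Finset.sum_congr rfl fun c _ => ?_
  rw [Complex.add_conj, mul_assoc]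
  simp

lemma integral_exp_sum_re [IsProbabilityMeasure P] (hM : IsHermitianStableMeasure α P M) {n : ℕ}
    (A : Fin n → Set ℝ) (hA : ∀ i, MeasurableSet (A i)) (hA' : ∀ i, volume (A i) < ⊤)
    (hA0 : ∀ i, A i ⊆ Ici 0) (hd : Pairwise fun i j => Disjoint (A i) (A j)) (c : Fin n → ℂ) :
    ∫ ω, Complex.exp (Complex.I * ((∑ i, (c i * M (A i) ω).re : ℝ) : ℂ)) ∂P =
      ((Real.exp (-∑ i, ((volume (A i)).toReal * ‖c i‖ ^ α)) : ℝ) : ℂ) := by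
  have h := (hM.indep n A hA hA' hA0 hd).integral_fun_prod_comp
    (f := fun i z => Complex.exp (Complex.I * ((c i * z).re : ℝ)))
    (fun i => (hM.measurable _ (hA i) (hA' i)).aemeasurable)
    (fun i => (by fun_prop : Continuous fun z : ℂ =>
      Complex.exp (Complex.I * ((c i * z).re : ℝ))).aestronglyMeasurable)
  simp only [hM.integral_exp_re_mul (hA _) (hA' _) (hA0 _)] at h
  rw [← Finset.sum_neg_distrib, Real.exp_sum, Complex.ofReal_prod, ← h]
  refine integral_congr_ae (.of_forall fun ω => ?_)
  simp only
  rw [Complex.ofReal_sum, Finset.mul_sum, Complex.exp_sum]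

lemma integral_exp_finset_sum_re [IsProbabilityMeasure P] (hM : IsHermitianStableMeasure α P M)
    {ι : Type*} (s : Finset ι) (A : ι → Set ℝ) (hA : ∀ i ∈ s, MeasurableSet (A i))
    (hA' : ∀ i ∈ s, volume (A i) < ⊤) (hA0 : ∀ i ∈ s, A i ⊆ Ici 0)
    (hd : ∀ i ∈ s, ∀ j ∈ s, i ≠ j → Disjoint (A i) (A j)) (c : ι → ℂ) :
    ∫ ω, Complex.exp (Complex.I * ((∑ i ∈ s, (c i * M (A i) ω).re : ℝ) : ℂ)) ∂P =
      ((Real.exp (-∑ i ∈ s, ((volume (A i)).toReal * ‖c i‖ ^ α)) : ℝ) : ℂ) := by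
  let e := s.equivFin.symm
  have h := hM.integral_exp_sum_re (fun i => A (e i)) (fun i => hA _ (e i).2)
    (fun i => hA' _ (e i).2) (fun i => hA0 _ (e i).2)
    (fun i j hij => hd _ (e i).2 _ (e j).2 fun h => hij (e.injective (Subtype.ext h)))
    (fun i => c (e i))
  have hs : ∀ f : ι → ℝ, ∑ i, f (e i) = ∑ i ∈ s, f i := fun f => by
    rw [Equiv.sum_comp e (fun i : s => f i), Finset.sum_coe_sort s f]
  rw [hs fun i => (volume (A i)).toReal * ‖c i‖ ^ α] at h
  rw [← h]
  refine integral_congr_ae (.of_forall fun ω => ?_)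
  simp only
  rw [hs fun i => (c i * M (A i) ω).re]

lemma integral_exp_simpleStochIntegral [IsProbabilityMeasure P]
    (hM : IsHermitianStableMeasure α P M) (hα : 0 < α) {φ : SimpleFunc ℝ ℂ}
    (hφ : φ.FinMeasSupp volume) (hsymm : ∀ x, φ (-x) = (starRingEnd ℂ) (φ x)) :
    ∫ ω, Complex.exp (Complex.I * simpleStochIntegral M φ ω) ∂P =
      ((Real.exp (-(2 * (eLpNorm φ (ENNReal.ofReal α) (volume.restrict (Ioi 0))).toReal) ^ α) : ℝ)
        : ℂ) := by
  have h := hM.integral_exp_finset_sum_re (φ.range.erase 0) (fun c => φ ⁻¹' {c} ∩ Ioi 0)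
    (fun c _ => (φ.measurableSet_fiber c).inter measurableSet_Ioi)
    (fun c hc => (measure_mono inter_subset_left).trans_lt
      (hφ.meas_preimage_singleton_ne_zero (Finset.ne_of_mem_erase hc)))
    (fun c _ => inter_subset_right.trans Ioi_subset_Ici_self)
    (fun c _ d _ hcd => ((disjoint_singleton.2 hcd).preimage φ).mono inter_subset_left
      inter_subset_left) (fun c => 2 * c)
  have h1 : (2 * (eLpNorm φ (ENNReal.ofReal α) (volume.restrict (Ioi 0))).toReal) ^ α =
      ∑ c ∈ φ.range.erase 0, (volume (φ ⁻¹' {c} ∩ Ioi 0)).toReal * ‖2 * c‖ ^ α := by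
    rw [eLpNorm_eq_eLpNorm' (by simpa using hα) ENNReal.ofReal_ne_top,
      ENNReal.toReal_ofReal hα.le, SimpleFunc.eLpNorm'_eq, Real.mul_rpow (by norm_num)
      ENNReal.toReal_nonneg, ENNReal.toReal_rpow, ← ENNReal.rpow_mul, one_div,
      inv_mul_cancel₀ hα.ne', ENNReal.rpow_one]
    rw [← Finset.sum_erase (a := 0) φ.range (by simp [hα]), ENNReal.toReal_sum, Finset.mul_sum]
    · refine Finset.sum_congr rfl fun c _ => ?_
      rw [Measure.restrict_apply (φ.measurableSet_fiber c), ENNReal.toReal_mul, norm_mul,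
        Real.mul_rpow (norm_nonneg _) (norm_nonneg _), ← ENNReal.toReal_rpow, toReal_enorm]
      simp only [Complex.norm_ofNat]
      ring
    · intro c hc
      refine ENNReal.mul_ne_top (ENNReal.rpow_ne_top_of_nonneg hα.le enorm_ne_top) ?_
      exact ((Measure.restrict_apply_le _ _).trans_lt
        (hφ.meas_preimage_singleton_ne_zero (Finset.ne_of_mem_erase hc))).ne
  rw [h1, ← h]
  refine integral_congr_ae ?_
  filter_upwards [hM.simpleStochIntegral_eq_sum_re hφ hsymm] with ω hω
  rw [hω]

end IsHermitianStableMeasure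

/-! ### General integrands and the stable norm as a norm in `L^α(0, ∞)` -/

/-- `ξ` is almost surely the limit of integrals of Hermitian simple functions that converge to `f`
in `L^α(0, ∞)`. -/
def IsAEStochIntegral {Ω : Type*} [MeasurableSpace Ω] (α : ℝ) (P : Measure Ω)
    (M : Set ℝ → Ω → ℂ) (f : ℝ → ℂ) (ξ : Ω → ℝ) : Prop :=
  ∃ φ : ℕ → SimpleFunc ℝ ℂ,
    (∀ n x, φ n (-x) = (starRingEnd ℂ) (φ n x)) ∧
    (∀ n, (φ n).FinMeasSupp volume) ∧
    Tendsto (fun n => eLpNorm (f - ⇑(φ n)) (ENNReal.ofReal α) (volume.restrict (Ioi 0)))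
      atTop (𝓝 0) ∧
    ∀ᵐ ω ∂P, Tendsto (fun n => simpleStochIntegral M (φ n) ω) atTop (𝓝 (ξ ω : ℂ))

section

variable {Ω : Type*} [MeasurableSpace Ω] {P : Measure Ω} {α : ℝ} {M : Set ℝ → Ω → ℂ}

/-- Convergence in probability gives an almost surely convergent subsequence. In this form sums and
limits of characteristic functions are immediate. -/
lemma IsStochIntegral.isAEStochIntegral {f : ℝ → ℂ} {ξ : Ω → ℝ} (h : IsStochIntegral α P M f ξ) :
    IsAEStochIntegral α P M f ξ := by
  obtain ⟨φ, h1, h2, h3, h4⟩ := h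
  obtain ⟨ns, hns, hlim⟩ := h4.exists_seq_tendsto_ae
  refine ⟨fun n => φ (ns n), fun n => h1 _, fun n => h2 _, ?_, hlim⟩
  refine tendsto_of_tendsto_of_tendsto_of_le_of_le tendsto_const_nhds
    (h3.comp hns.tendsto_atTop) (fun _ => zero_le) fun n => ?_
  exact eLpNorm_mono_measure _ Measure.restrict_le_self

namespace IsAEStochIntegral

lemma add (hM : IsHermitianStableMeasure α P M) (hα : 1 ≤ α) {f g : ℝ → ℂ} {ξ η : Ω → ℝ}
    (hf : Measurable f) (hg : Measurable g)
    (hξ : IsAEStochIntegral α P M f ξ) (hη : IsAEStochIntegral α P M g η) :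
    IsAEStochIntegral α P M (f + g) (ξ + η) := by
  obtain ⟨φ, h1, h2, h3, h4⟩ := hξ
  obtain ⟨ψ, k1, k2, k3, k4⟩ := hη
  refine ⟨fun n => φ n + ψ n, fun n x => by simp [h1, k1], fun n => (h2 n).add (k2 n), ?_, ?_⟩
  · have h5 := h3.add k3
    rw [add_zero] at h5
    refine tendsto_of_tendsto_of_tendsto_of_le_of_le tendsto_const_nhds h5
      (fun _ => zero_le) fun n => ?_
    have : f + g - ⇑(φ n + ψ n) = (f - φ n) + (g - ψ n) := by
      rw [SimpleFunc.coe_add]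
      ring
    simp only [this]
    exact eLpNorm_add_le (hf.sub (φ n).measurable).aestronglyMeasurable
      (hg.sub (ψ n).measurable).aestronglyMeasurable (by simpa using hα)
  · have h5 := ae_all_iff.2 fun n => hM.simpleStochIntegral_add (h2 n) (k2 n)
    filter_upwards [h4, k4, h5] with ω h4 k4 h5
    simp only [h5, Pi.add_apply, Complex.ofReal_add]
    exact h4.add k4

lemma const_smul (hM : IsHermitianStableMeasure α P M) {f : ℝ → ℂ} {ξ : Ω → ℝ}
    (hξ : IsAEStochIntegral α P M f ξ) (a : ℝ) :
    IsAEStochIntegral α P M (a • f) (a • ξ) := by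
  obtain ⟨φ, h1, h2, h3, h4⟩ := hξ
  refine ⟨fun n => (φ n).map ((a : ℂ) * ·), fun n x => by simp [h1],
    fun n => (h2 n).map (by simp), ?_, ?_⟩
  · have h5 := ENNReal.Tendsto.const_mul (a := ‖a‖ₑ) h3 (Or.inr enorm_ne_top)
    rw [mul_zero] at h5
    refine h5.congr fun n => ?_
    rw [← eLpNorm_const_smul]
    congr 1
    ext x
    simp [mul_sub]
  · have h5 := ae_all_iff.2 fun n => hM.simpleStochIntegral_const_mul (h2 n) a
    filter_upwards [h4, h5] with ω h4 h5
    simp only [h5, Pi.smul_apply, smul_eq_mul, Complex.ofReal_mul]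
    exact h4.const_mul _

lemma zero : IsAEStochIntegral α P M 0 0 := by
  refine ⟨fun _ => 0, fun n x => by simp, fun n => SimpleFunc.finMeasSupp_iff.2 ?_, by simp, ?_⟩
  · intro y hy
    have : ⇑(0 : SimpleFunc ℝ ℂ) ⁻¹' {y} = ∅ := by
      ext x
      simpa using hy.symm
    rw [this, measure_empty]
    exact ENNReal.zero_lt_top
  · refine .of_forall fun ω => tendsto_const_nhds.congr fun n => ?_
    rw [simpleStochIntegral, Finset.sum_eq_zero]
    · simp
    · intro c hc
      obtain ⟨x, rfl⟩ := SimpleFunc.mem_range.1 hc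
      simp

lemma sum (hM : IsHermitianStableMeasure α P M) (hα : 1 ≤ α) {ι : Type*} (s : Finset ι)
    {f : ι → ℝ → ℂ} {ξ : ι → Ω → ℝ} (hf : ∀ i, Measurable (f i))
    (hξ : ∀ i, IsAEStochIntegral α P M (f i) (ξ i)) :
    IsAEStochIntegral α P M (∑ i ∈ s, f i) (∑ i ∈ s, ξ i) := by
  classical
  induction s using Finset.induction_on with
  | empty => simpa using zero
  | insert a s ha ih =>
    rw [Finset.sum_insert ha, Finset.sum_insert ha]
    exact add hM hα (hf a) (by
      rw [Finset.sum_fn]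
      exact Finset.measurable_fun_sum _ fun i _ => hf i) (hξ a) ih

/-- The function is in `L^α(0, ∞)`, and twice its norm is the norm of the integral. -/
theorem stableNorm_eq [IsProbabilityMeasure P] (hM : IsHermitianStableMeasure α P M) (hα : 1 ≤ α)
    {f : ℝ → ℂ} {ξ : Ω → ℝ} (hf : Measurable f) (hξ : IsAEStochIntegral α P M f ξ) :
    eLpNorm f (ENNReal.ofReal α) (volume.restrict (Ioi 0)) ≠ ⊤ ∧
    stableNorm α P ξ =
      2 * (eLpNorm f (ENNReal.ofReal α) (volume.restrict (Ioi 0))).toReal := by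
  have hα0 : 0 < α := by linarith
  have hα1 : 1 ≤ ENNReal.ofReal α := by simpa using hα
  obtain ⟨φ, h1, h2, h3, h4⟩ := hξ
  set μ : Measure ℝ := volume.restrict (Ioi 0)
  set p := ENNReal.ofReal α
  have hle1 : ∀ n, eLpNorm f p μ ≤ eLpNorm (f - ⇑(φ n)) p μ + eLpNorm (φ n) p μ := fun n => by
    have := eLpNorm_add_le (μ := μ) (hf.sub (φ n).measurable).aestronglyMeasurable
      (φ n).measurable.aestronglyMeasurable hα1
    rwa [sub_add_cancel] at this
  have hle2 : ∀ n, eLpNorm (φ n) p μ ≤ eLpNorm (f - ⇑(φ n)) p μ + eLpNorm f p μ := fun n => by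
    have := eLpNorm_sub_le (μ := μ) hf.aestronglyMeasurable
      (hf.sub (φ n).measurable).aestronglyMeasurable hα1
    rwa [sub_sub_cancel, add_comm] at this
  have hfin : ∀ n, eLpNorm (φ n) p μ < ⊤ := fun n =>
    ((((SimpleFunc.memLp_iff (by simp [hα0]) ENNReal.ofReal_ne_top).2
      (SimpleFunc.finMeasSupp_iff.1 (h2 n))).restrict _).2)
  have htop : eLpNorm f p μ ≠ ⊤ := by
    obtain ⟨n, hn⟩ := (h3.eventually_lt_const ENNReal.zero_lt_top).exists
    exact ((hle1 n).trans_lt (ENNReal.add_lt_top.2 ⟨hn, hfin n⟩)).ne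
  refine ⟨htop, ?_⟩
  have hlim : Tendsto (fun n => eLpNorm (φ n) p μ) atTop (𝓝 (eLpNorm f p μ)) := by
    have hlow := ENNReal.Tendsto.sub (tendsto_const_nhds (x := eLpNorm f p μ) (f := atTop)) h3
      (Or.inl htop)
    have hup := h3.add (tendsto_const_nhds (x := eLpNorm f p μ))
    rw [tsub_zero] at hlow
    rw [zero_add] at hup
    exact tendsto_of_tendsto_of_tendsto_of_le_of_le hlow hup
      (fun n => tsub_le_iff_left.2 (hle1 n)) hle2
  have hlim' := (ENNReal.tendsto_toReal htop).comp hlim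
  have hmeas : ∀ n, Measurable fun ω => ∑ c ∈ (φ n).range.erase 0,
      ((2 * c) * M ((φ n) ⁻¹' {c} ∩ Ioi 0) ω).re := fun n =>
    Finset.measurable_fun_sum _ fun c hc => Complex.measurable_re.comp
      ((hM.measurable _ (((φ n).measurableSet_fiber c).inter measurableSet_Ioi)
      ((measure_mono inter_subset_left).trans_lt
      ((h2 n).meas_preimage_singleton_ne_zero (Finset.ne_of_mem_erase hc)))).const_mul _)
  have hreal := fun n => hM.simpleStochIntegral_eq_sum_re (h2 n) (h1 n)
  -- The simple integrals are almost surely real, so the exponentials have modulus one and dominated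
  -- convergence applies.
  have hint : Tendsto (fun n => ∫ ω, Complex.exp (Complex.I * simpleStochIntegral M (φ n) ω) ∂P)
      atTop (𝓝 (∫ ω, Complex.exp (Complex.I * (ξ ω : ℂ)) ∂P)) := by
    refine tendsto_integral_of_dominated_convergence (fun _ => (1 : ℝ)) (fun n => ?_)
      (integrable_const _) (fun n => ?_) ?_
    · refine AEStronglyMeasurable.congr (f := fun ω => Complex.exp (Complex.I *
        ((∑ c ∈ (φ n).range.erase 0, ((2 * c) * M ((φ n) ⁻¹' {c} ∩ Ioi 0) ω).re : ℝ) : ℂ))) ?_ ?_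
      · exact (Complex.measurable_exp.comp
          ((Complex.measurable_ofReal.comp (hmeas n)).const_mul _)).aestronglyMeasurable
      · filter_upwards [hreal n] with ω hω
        rw [hω]
    · filter_upwards [hreal n] with ω hω
      rw [hω, mul_comm, Complex.norm_exp_ofReal_mul_I]
    · filter_upwards [h4] with ω hω
      exact (Complex.continuous_exp.tendsto _).comp (hω.const_mul _)
  simp only [hM.integral_exp_simpleStochIntegral hα0 (h2 _) (h1 _)] at hint
  have hcont : Continuous fun x : ℝ => ((Real.exp (-(2 * x) ^ α) : ℝ) : ℂ) := by
    have : Continuous fun x : ℝ => (2 * x) ^ α :=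
      (continuous_const.mul continuous_id).rpow_const fun _ => Or.inr hα0.le
    fun_prop
  have heq := tendsto_nhds_unique hint ((hcont.tendsto _).comp hlim')
  rw [stableNorm, heq, Complex.ofReal_re, Real.log_exp, neg_neg, one_div,
    Real.rpow_rpow_inv (by positivity) hα0.ne']

end IsAEStochIntegral

end

/-! ### A Remez-type inequality for sums of polynomials times products of powers -/

/-- The holomorphic function `ζ ↦ ∏ i, (1 + p i * ζ) ^ μ i`. -/
def powProd {k : ℕ} (p : Fin k → ℂ) (μ : Fin k → ℝ) (ζ : ℂ) : ℂ :=
  Complex.exp (∑ i, (μ i : ℂ) * Complex.log (1 + p i * ζ))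

/-- Sums `∑ j, P j * powProd p (μ j)` with `deg (P j) < D j` and exponents bounded by `B`, where
`D` is a list of natural numbers. -/
def IsPowSum {k : ℕ} (p : Fin k → ℂ) (B : ℝ) : List ℕ → (ℂ → ℂ) → Prop
  | [], F => F = 0
  | d :: D, F => ∃ (Q : Polynomial ℂ) (μ : Fin k → ℝ) (G : ℂ → ℂ), Q ∈ Polynomial.degreeLT ℂ d ∧
      (∀ i, |μ i| ≤ B) ∧ IsPowSum p B D G ∧ F = fun ζ => Q.eval ζ * powProd p μ ζ + G ζ

lemma one_add_mul_mem_slitPlane {p ζ : ℂ} (hp : ‖p‖ ≤ 1) (hζ : ‖ζ‖ < 1) :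
    1 + p * ζ ∈ Complex.slitPlane := by
  apply Complex.mem_slitPlane_of_norm_lt_one
  rw [norm_mul]
  exact (mul_le_of_le_one_left (norm_nonneg _) hp).trans_lt hζ

lemma powProd_ne_zero {k : ℕ} (p : Fin k → ℂ) (μ : Fin k → ℝ) (ζ : ℂ) : powProd p μ ζ ≠ 0 :=
  Complex.exp_ne_zero _

lemma powProd_sub {k : ℕ} (p : Fin k → ℂ) (μ μ' : Fin k → ℝ) (ζ : ℂ) :
    powProd p (fun i => μ i - μ' i) ζ = powProd p μ ζ / powProd p μ' ζ := by
  simp only [powProd, ← Complex.exp_sub, ← Finset.sum_sub_distrib]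
  congr 1
  refine Finset.sum_congr rfl fun i _ => ?_
  push_cast
  ring

/-- The polynomial `∑ i, μ i * p i * ∏ j ≠ i, (1 + p j * ζ)`. -/
def powProdNum {k : ℕ} (p : Fin k → ℂ) (μ : Fin k → ℝ) : Polynomial ℂ :=
  ∑ i, Polynomial.C ((μ i : ℂ) * p i) *
    ∏ j ∈ Finset.univ.erase i, (1 + Polynomial.C (p j) * Polynomial.X)

/-- The polynomial `∏ i, (1 + p i * ζ)`. -/
def powProdDen {k : ℕ} (p : Fin k → ℂ) : Polynomial ℂ :=
  ∏ j, (1 + Polynomial.C (p j) * Polynomial.X)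

lemma natDegree_prod_one_add_le {k : ℕ} (p : Fin k → ℂ) (s : Finset (Fin k)) :
    (∏ j ∈ s, (1 + Polynomial.C (p j) * Polynomial.X)).natDegree ≤ s.card := by
  refine (Polynomial.natDegree_prod_le _ _).trans ?_
  rw [Finset.card_eq_sum_ones]
  refine Finset.sum_le_sum fun i _ => ?_
  compute_degree

lemma natDegree_powProdDen_le {k : ℕ} (p : Fin k → ℂ) : (powProdDen p).natDegree ≤ k := by
  simpa [powProdDen] using natDegree_prod_one_add_le p Finset.univ

lemma natDegree_powProdNum_le {k : ℕ} (p : Fin k → ℂ) (μ : Fin k → ℝ) :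
    (powProdNum p μ).natDegree ≤ k := by
  refine Polynomial.natDegree_sum_le_of_forall_le _ _ fun i _ => ?_
  refine (Polynomial.natDegree_C_mul_le _ _).trans ((natDegree_prod_one_add_le p _).trans ?_)
  exact (Finset.card_le_univ _).trans (by simp)

lemma powProd_one {k : ℕ} (p : Fin k → ℂ) (hp : ∀ i, ‖p i‖ ≤ 1) {ζ : ℂ} (hζ : ‖ζ‖ < 1) :
    powProd p (fun _ => 1) ζ = (powProdDen p).eval ζ := by
  simp only [powProd, powProdDen, Complex.exp_sum, Polynomial.eval_prod]
  refine Finset.prod_congr rfl fun i _ => ?_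
  have := Complex.slitPlane_ne_zero (one_add_mul_mem_slitPlane (hp i) hζ)
  simp [Complex.exp_log this]

/-- The logarithmic derivative is `powProdNum` over `powProdDen`, and division by `powProdDen`
lowers every exponent by one. Hence the class of polynomials times products of powers is stable
under differentiation. -/
lemma hasDerivAt_powProd {k : ℕ} (p : Fin k → ℂ) (hp : ∀ i, ‖p i‖ ≤ 1) (μ : Fin k → ℝ) {ζ : ℂ}
    (hζ : ‖ζ‖ < 1) :
    HasDerivAt (powProd p μ) ((powProdNum p μ).eval ζ * powProd p (fun i => μ i - 1) ζ) ζ := by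
  have h1 : HasDerivAt (fun z => ∑ i, (μ i : ℂ) * Complex.log (1 + p i * z))
      (∑ i, (μ i : ℂ) * (p i / (1 + p i * ζ))) ζ := by
    refine HasDerivAt.fun_sum fun i _ => ?_
    refine HasDerivAt.const_mul _ ?_
    refine HasDerivAt.clog ?_ (one_add_mul_mem_slitPlane (hp i) hζ)
    simpa using ((hasDerivAt_id ζ).const_mul (p i)).const_add 1
  refine h1.cexp.congr_deriv ?_
  rw [powProd_sub p μ (fun _ => 1), powProd_one p hp hζ, powProd, mul_div_left_comm]
  congr 1
  simp only [powProdNum, powProdDen, Polynomial.eval_prod, Polynomial.eval_finsetSum,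
    Polynomial.eval_mul, Polynomial.eval_C, Polynomial.eval_add, Polynomial.eval_one,
    Polynomial.eval_X, Finset.sum_div]
  refine Finset.sum_congr rfl fun i _ => ?_
  rw [← Finset.mul_prod_erase Finset.univ (fun j => 1 + p j * ζ) (Finset.mem_univ i)]
  have h2 : ∏ j ∈ Finset.univ.erase i, (1 + p j * ζ) ≠ 0 := 
    Finset.prod_ne_zero_iff.2 fun j _ => Complex.slitPlane_ne_zero (one_add_mul_mem_slitPlane (hp j) hζ)
  rw [mul_div_mul_right _ _ h2, mul_div_assoc]

lemma exists_norm_powProd_le (k : ℕ) (B : ℝ) : ∃ C : ℝ, 0 < C ∧ ∀ (p : Fin k → ℂ) (μ : Fin k → ℝ)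
    (ζ : ℂ), (∀ i, ‖p i‖ ≤ 1) → (∀ i, |μ i| ≤ B) → ‖ζ‖ ≤ 1 / 2 → ‖powProd p μ ζ‖ ≤ C := by
  -- Each of the `k` logarithms is at most $\tfrac32\cdot\tfrac12=\tfrac34$ in modulus.
  refine ⟨Real.exp (k * (B * (3 / 4))), Real.exp_pos _, fun p μ ζ hp hμ hζ => ?_⟩
  rw [powProd, Complex.norm_exp]
  refine Real.exp_le_exp.2 ((Complex.re_le_norm _).trans ((norm_sum_le _ _).trans ?_))
  refine (Finset.sum_le_card_nsmul _ _ (B * (3 / 4)) fun i _ => ?_).trans (by simp)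
  rw [norm_mul, Complex.norm_real, Real.norm_eq_abs]
  have h1 : ‖p i * ζ‖ ≤ 1 / 2 := by
    rw [norm_mul]
    exact (mul_le_of_le_one_left (norm_nonneg _) (hp i)).trans hζ
  have h2 := Complex.norm_log_one_add_half_le_self h1
  exact mul_le_mul (hμ i) (h2.trans (by linarith)) (norm_nonneg _) ((abs_nonneg _).trans (hμ i))

lemma IsPowSum.differentiableAt {k : ℕ} {p : Fin k → ℂ} (hp : ∀ i, ‖p i‖ ≤ 1) {B : ℝ} :
    ∀ {D : List ℕ} {F : ℂ → ℂ}, IsPowSum p B D F → ∀ {ζ : ℂ}, ‖ζ‖ < 1 → DifferentiableAt ℂ F ζ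
  | [], F, h, ζ, _ => by
    rw [h]
    exact differentiableAt_const 0
  | _ :: _, F, ⟨Q, μ, G, _, _, hG, hF⟩, ζ, hζ => by
    rw [hF]
    exact (Q.differentiableAt.mul (hasDerivAt_powProd p hp μ hζ).differentiableAt).add
      (hG.differentiableAt hp hζ)

lemma IsPowSum.add {k : ℕ} {p : Fin k → ℂ} {B : ℝ} : ∀ {D E : List ℕ} {F G : ℂ → ℂ},
    IsPowSum p B D F → IsPowSum p B E G → IsPowSum p B (D ++ E) (F + G)
  | [], _, F, G, h, hG => by
    rw [h, zero_add]
    exact hG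
  | _ :: _, _, F, G, ⟨Q, μ, F', hQ, hμ, hF', hF⟩, hG => by
    refine ⟨Q, μ, F' + G, hQ, hμ, hF'.add hG, ?_⟩
    rw [hF]
    ext ζ
    simp [add_assoc]

lemma hasDerivAt_mul_powProd {k : ℕ} {p : Fin k → ℂ} (hp : ∀ i, ‖p i‖ ≤ 1) (Q : Polynomial ℂ)
    (μ : Fin k → ℝ) {ζ : ℂ} (hζ : ‖ζ‖ < 1) :
    HasDerivAt (fun z => Q.eval z * powProd p μ z)
      ((Q.derivative * powProdDen p + Q * powProdNum p μ).eval ζ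
        * powProd p (fun i => μ i - 1) ζ) ζ := by
  refine ((Q.hasDerivAt ζ).mul (hasDerivAt_powProd p hp μ hζ)).congr_deriv ?_
  have h := powProd_sub p μ (fun _ => 1) ζ
  rw [powProd_one p hp hζ] at h
  have hne : (powProdDen p).eval ζ ≠ 0 := by
    rw [← powProd_one p hp hζ]
    exact powProd_ne_zero _ _ _
  rw [eq_div_iff hne] at h
  rw [← h]
  simp only [Polynomial.eval_add, Polynomial.eval_mul]
  ring

lemma mem_degreeLT_derivative_mul {k d : ℕ} (p : Fin k → ℂ) {Q : Polynomial ℂ}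
    (hQ : Q ∈ Polynomial.degreeLT ℂ d) (μ : Fin k → ℝ) :
    Q.derivative * powProdDen p + Q * powProdNum p μ ∈ Polynomial.degreeLT ℂ (d + k) := by
  have key : ∀ R S : Polynomial ℂ, R.degree < d → S.natDegree ≤ k →
      R * S ∈ Polynomial.degreeLT ℂ (d + k) := by
    intro R S hR hS
    rw [Polynomial.mem_degreeLT, Polynomial.degree_mul]
    by_cases hS0 : S = 0
    · simp [hS0]
    rw [Polynomial.degree_eq_natDegree hS0]
    by_cases hR0 : R = 0
    · simp [hR0]
    rw [Polynomial.degree_eq_natDegree hR0] at hR ⊢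
    norm_cast at hR ⊢
    omega
  have hQ' := Polynomial.mem_degreeLT.1 hQ
  exact Submodule.add_mem _
    (key _ _ (Polynomial.degree_derivative_le.trans_lt hQ') (natDegree_powProdDen_le p))
    (key _ _ hQ' (natDegree_powProdNum_le p μ))

/-- Division by one of the products, followed by differentiation. -/
lemma IsPowSum.exists_hasDerivAt_div {k : ℕ} {p : Fin k → ℂ} (hp : ∀ i, ‖p i‖ ≤ 1) {B : ℝ}
    {ν : Fin k → ℝ} (hν : ∀ i, |ν i| ≤ B) : ∀ {D : List ℕ} {F : ℂ → ℂ}, IsPowSum p B D F →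
      ∃ G, IsPowSum p (2 * B + 1) (D.map (· + k)) G ∧
        ∀ ζ : ℂ, ‖ζ‖ < 1 → HasDerivAt (fun z => F z / powProd p ν z) (G ζ) ζ
  | [], F, h => by
    refine ⟨0, rfl, fun ζ _ => ?_⟩
    rw [h]
    simpa using hasDerivAt_const ζ (0 : ℂ)
  | d :: D, F, ⟨Q, μ, F', hQ, hμ, hF', hF⟩ => by
    obtain ⟨G, hG, hder⟩ := IsPowSum.exists_hasDerivAt_div hp hν hF'
    refine ⟨_, ⟨_, fun i => μ i - ν i - 1, G,
      mem_degreeLT_derivative_mul p hQ (fun i => μ i - ν i), fun i => ?_, hG, rfl⟩,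
      fun ζ hζ => ?_⟩
    · have h1 := abs_le.1 (hμ i)
      have h2 := abs_le.1 (hν i)
      exact abs_le.2 ⟨by linarith, by linarith⟩
    · have heq : (fun z => F z / powProd p ν z) = (fun z => Q.eval z *
          powProd p (fun i => μ i - ν i) z) + fun z => F' z / powProd p ν z := by
        ext z
        simp only [hF, powProd_sub, Pi.add_apply]
        ring
      rw [heq]
      exact (hasDerivAt_mul_powProd hp Q (fun i => μ i - ν i) hζ).add (hder ζ hζ)

/-- Uniform boundedness on the disc of radius `1 / 2` in terms of bounds on small discs. -/
def HasRemezBound (k : ℕ) (D : List ℕ) : Prop :=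
  ∀ (B : ℝ) (z : ℂ) (ρ : ℝ), 0 < ρ → ‖z‖ + ρ ≤ 1 / 2 → ∃ C : ℝ, 0 < C ∧
    ∀ (p : Fin k → ℂ) (F : ℂ → ℂ) (m : ℝ), (∀ i, ‖p i‖ ≤ 1) → IsPowSum p B D F →
      (∀ ζ, ‖ζ - z‖ ≤ ρ → ‖F ζ‖ ≤ m) → ∀ ζ, ‖ζ‖ ≤ 1 / 2 → ‖F ζ‖ ≤ C * m

/-- Divide by the first product and differentiate: the first polynomial loses a degree. Cauchy's
estimate bounds the derivative on the disc of half the radius, the hypothesis carries this bound to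
the large disc, and the mean value inequality from `z` recovers the function. -/
lemma HasRemezBound.cons {k d : ℕ} {D : List ℕ} (h : HasRemezBound k (d :: D.map (· + k))) :
    HasRemezBound k ((d + 1) :: D) := by
  intro B z ρ hρ hz
  obtain ⟨C, hC, hR⟩ := h (2 * B + 1) z (ρ / 2) (by positivity) (by linarith)
  obtain ⟨A, hA, hg⟩ := exists_norm_powProd_le k B
  have key : ∀ (p : Fin k → ℂ) (F : ℂ → ℂ) (m : ℝ), (∀ i, ‖p i‖ ≤ 1) →
      IsPowSum p B ((d + 1) :: D) F → (∀ ζ, ‖ζ - z‖ ≤ ρ → ‖F ζ‖ ≤ m) →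
      ∀ ζ, ‖ζ‖ ≤ 1 / 2 → ‖F ζ‖ ≤ A * (A * m + C * (A * m / (ρ / 2)) * 1) := by
    rintro p F m hp ⟨Q, μ, F', hQ, hμ, hF', hF⟩ hm ζ hζ
    obtain ⟨G, hG, hder⟩ := IsPowSum.exists_hasDerivAt_div hp hμ hF'
    have hinv : ∀ ζ, ‖ζ‖ ≤ 1 / 2 → ‖(powProd p μ ζ)⁻¹‖ ≤ A := by
      intro ζ hζ
      have := hg p (fun i => - μ i) ζ hp (fun i => by simpa using hμ i) hζ
      convert this using 2
      simp [powProd, ← Complex.exp_neg]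
    set f : ℂ → ℂ := fun z => F z / powProd p μ z with hf
    have hfQ : f = fun z => Q.eval z + F' z / powProd p μ z := by
      ext w
      have := powProd_ne_zero p μ w
      simp only [hf, hF]
      field_simp
    set g : ℂ → ℂ := fun z => Q.derivative.eval z + G z with hgdef
    have hfd : ∀ ζ : ℂ, ‖ζ‖ < 1 → HasDerivAt f (g ζ) ζ := by
      intro w hw
      rw [hfQ]
      exact (Q.hasDerivAt w).add (hder w hw)
    -- The leading term is now a bare polynomial, that is, all its exponents are zero.
    have hgsum : IsPowSum p (2 * B + 1) (d :: D.map (· + k)) g := by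
      refine ⟨Q.derivative, fun _ => 0, G, ?_, fun i => ?_, hG, ?_⟩
      · rw [Polynomial.mem_degreeLT] at hQ ⊢
        by_cases hQ0 : Q = 0
        · simp [hQ0]
        · have h1 := Polynomial.degree_derivative_lt hQ0
          refine lt_of_lt_of_le h1 ?_
          rw [Polynomial.degree_eq_natDegree hQ0] at hQ ⊢
          norm_cast at hQ ⊢
          omega
      · have := (abs_nonneg _).trans (hμ i)
        simp only [abs_zero]
        linarith
      · simp [hgdef, powProd]
    have hsmall : ∀ w, ‖w - z‖ ≤ ρ → ‖w‖ ≤ 1 / 2 := by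
      intro w hw
      have := norm_add_le (w - z) z
      rw [sub_add_cancel] at this
      linarith
    have hfm : ∀ w, ‖w - z‖ ≤ ρ → ‖f w‖ ≤ A * m := by
      intro w hw
      simp only [hf, div_eq_mul_inv, norm_mul]
      rw [mul_comm]
      exact mul_le_mul (hinv w (hsmall w hw)) (hm w hw) (norm_nonneg _) hA.le
    have hgm : ∀ w, ‖w - z‖ ≤ ρ / 2 → ‖g w‖ ≤ A * m / (ρ / 2) := by
      intro w hw
      have hball : ∀ u, ‖u - w‖ ≤ ρ / 2 → ‖u - z‖ ≤ ρ := by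
        intro u hu
        have := norm_add_le (u - w) (w - z)
        rw [sub_add_sub_cancel] at this
        linarith
      rw [← (hfd w ((hsmall w (by linarith)).trans_lt (by norm_num))).deriv]
      refine Complex.norm_deriv_le_of_forall_mem_sphere_norm_le (by positivity) ?_ fun u hu => ?_
      · refine DifferentiableOn.diffContOnCl fun u hu => ?_
        rw [closure_ball _ (by positivity)] at hu
        have hu' : ‖u - w‖ ≤ ρ / 2 := by simpa [dist_eq_norm] using hu
        exact (hfd u ((hsmall u (hball u hu')).trans_lt
          (by norm_num))).differentiableAt.differentiableWithinAt
      · exact hfm u (hball u (by simpa [dist_eq_norm] using (le_of_eq (by simpa using hu))))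
    have hgbig := hR p g _ hp hgsum hgm
    have hzhalf : ‖z‖ ≤ 1 / 2 := by linarith
    have hmvt : ‖f ζ - f z‖ ≤ C * (A * m / (ρ / 2)) * ‖ζ - z‖ := by
      refine Convex.norm_image_sub_le_of_norm_hasDerivWithin_le (s := Metric.closedBall 0 (1 / 2))
        (f' := g) (fun u hu => ?_) (fun u hu => ?_) (convex_closedBall _ _) ?_ ?_
      · exact (hfd u ((by simpa using hu : ‖u‖ ≤ 2⁻¹).trans_lt (by norm_num))).hasDerivWithinAt
      · exact hgbig u (by simpa using hu)
      · simpa using hzhalf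
      · simpa using hζ
    have hd : ‖ζ - z‖ ≤ 1 := (norm_sub_le _ _).trans (by linarith)
    have hAm : 0 ≤ A * m := (norm_nonneg _).trans (hfm z (by simp [hρ.le]))
    have h3 : ‖f ζ‖ ≤ A * m + C * (A * m / (ρ / 2)) * 1 := by
      have h4 : ‖f ζ‖ ≤ ‖f z‖ + ‖f ζ - f z‖ := by
        have := norm_add_le (f z) (f ζ - f z)
        rwa [add_sub_cancel] at this
      refine h4.trans (add_le_add (hfm z (by simp [hρ.le])) (hmvt.trans ?_))
      gcongr
    have h5 : F ζ = powProd p μ ζ * f ζ := by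
      have := powProd_ne_zero p μ ζ
      simp only [hf]
      field_simp
    rw [h5, norm_mul]
    exact mul_le_mul (hg p μ ζ hp hμ hζ) h3 (norm_nonneg _) hA.le
  refine ⟨A * (A + C * (A / (ρ / 2))), by positivity, fun p F m hp hF hm ζ hζ => ?_⟩
  refine (key p F m hp hF hm ζ hζ).trans (le_of_eq ?_)
  ring

/-- Lexicographic induction on the number of terms and the degree bound of the first. A first bound
of `0` forces a zero polynomial, and the term disappears. -/
theorem hasRemezBound (k : ℕ) : ∀ (n : ℕ) (D : List ℕ), D.length = n → HasRemezBound k D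
  | 0, D, hD => by
    obtain rfl := List.length_eq_zero_iff.1 hD
    refine fun B z ρ hρ _ => ⟨1, one_pos, fun p F m _ hF hm ζ _ => ?_⟩
    have h0 : ∀ w, F w = 0 := fun w => by rw [hF]; rfl
    simpa [h0] using hm z (by simp [hρ.le])
  | n + 1, [], hD => by simp at hD
  | n + 1, d :: D, hD => by
    have hlen : D.length = n := by simpa using hD
    clear hD
    -- The tail must vary, since each differentiation raises its degree bounds by `k`.
    induction d generalizing D with
    | zero =>
      intro B z ρ hρ hz
      obtain ⟨C, hC, h⟩ := hasRemezBound k n D hlen B z ρ hρ hz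
      refine ⟨C, hC, fun p F m hp ⟨Q, μ, G, hQ, _, hG, hF⟩ hm => h p F m hp ?_ hm⟩
      have hQ0 : Q = 0 := by
        have := Polynomial.mem_degreeLT.1 hQ
        simpa using this
      have : F = G := by
        rw [hF]
        ext
        simp [hQ0]
      rwa [this]
    | succ d ih => exact HasRemezBound.cons (ih (D.map (· + k)) (by simpa using hlen))

lemma IsPowSum.const_mul_powProd {k : ℕ} {p : Fin k → ℂ} {B : ℝ} {μ : Fin k → ℝ}
    (hμ : ∀ i, |μ i| ≤ B) (b : ℂ) : IsPowSum p B [1] (fun ζ => b * powProd p μ ζ) := by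
  refine ⟨Polynomial.C b, μ, 0, ?_, hμ, rfl, by simp⟩
  rw [Polynomial.mem_degreeLT]
  exact Polynomial.degree_C_le.trans_lt (by norm_num)

lemma IsPowSum.sum {k : ℕ} {p : Fin k → ℂ} {B : ℝ} : ∀ {m : ℕ} {F : Fin m → ℂ → ℂ},
    (∀ i, IsPowSum p B [1] (F i)) → IsPowSum p B (List.replicate m 1) (∑ i, F i)
  | 0, _, _ => by simp [IsPowSum]
  | m + 1, F, h => by
    rw [Fin.sum_univ_succ, List.replicate_succ, ← List.singleton_append]
    exact (h 0).add (IsPowSum.sum fun i => h i.succ)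

/-! ### A power singularity cannot be cancelled by a regular sum -/

lemma norm_exp_neg_mul_log {ζ : ℂ} (hζ : ζ ≠ 0) (ν : ℝ) :
    ‖Complex.exp (-ν * Complex.log ζ)‖ = ‖ζ‖ ^ (-ν) := by
  rw [Complex.norm_exp, Real.rpow_def_of_pos (norm_pos_iff.2 hζ)]
  congr 1
  rw [← Complex.ofReal_neg, Complex.re_ofReal_mul, Complex.log_re, mul_comm]

/-- A singularity `ζ ^ (-ν)` cannot be approximated well by functions that are regular at `0`. -/
theorem exists_le_of_norm_add_isPowSum_le (k : ℕ) (D : List ℕ) {ν₀ b₀ b₁ : ℝ} (hν₀ : 0 < ν₀)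
    (hb₀ : 0 < b₀) :
    ∃ c : ℝ, 0 < c ∧ ∀ (p : Fin k → ℂ) (F : ℂ → ℂ) (ν b A : ℝ), (∀ i, ‖p i‖ ≤ 1) →
      IsPowSum p 2 D F → ν ∈ Icc ν₀ 2 → b ∈ Icc b₀ b₁ →
      (∀ ζ : ℂ, 0 < ζ.re → ‖ζ‖ ≤ 1 / 2 →
        ‖b * Complex.exp (-ν * Complex.log ζ) + F ζ‖ ≤ A * (ζ.re ^ 2)⁻¹) → c ≤ A := by
  -- This disc lies in $\mathrm{Re}\,\zeta\ge 1/8$, where both the singular term and the weight are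
  -- under control, with constant $8^2=64$.
  obtain ⟨C, hC, hR⟩ := hasRemezBound k _ D rfl 2 (1 / 4) (1 / 8) (by norm_num) (by norm_num)
  -- At `η` the singular term exceeds by `1` the part of the bound for `F` that does not involve
  -- `A`, so the terms with `A` must make up the difference.
  obtain ⟨η, hη, hη0, hη1⟩ : ∃ η : ℝ, (C * (64 * b₁) + 1) / b₀ ≤ η ^ (-ν₀) ∧ 0 < η ∧ η < 1 / 2 := by
    have h1 := (tendsto_rpow_neg_nhdsGT_zero (neg_lt_zero.2 hν₀)).eventually_ge_atTop ((C * (64 * b₁) + 1) / b₀)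
    have h2 : ∀ᶠ η : ℝ in 𝓝[>] 0, η ∈ Ioo (0 : ℝ) (1 / 2) := Ioo_mem_nhdsGT (by norm_num)
    obtain ⟨η, h3, h4⟩ := (h1.and h2).exists
    exact ⟨η, h3, h4.1, h4.2⟩
  refine ⟨(C * 64 + (η ^ 2)⁻¹)⁻¹, by positivity, ?_⟩
  rintro p F ν b A hp hF ⟨hν, hν2⟩ ⟨hb, hb1⟩ h
  have hbpos : 0 < b := hb₀.trans_le hb
  have hA : 0 ≤ A := by
    have := (norm_nonneg _).trans (h (1 / 2) (by norm_num) (by norm_num))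
    norm_num at this
    linarith
  have hsmall : ∀ ζ : ℂ, ‖ζ - 1 / 4‖ ≤ 1 / 8 → ‖F ζ‖ ≤ 64 * b₁ + 64 * A := by
    intro ζ hζ
    have hre : 1 / 8 ≤ ζ.re := by
      have h1 := (Complex.abs_re_le_norm (ζ - 1 / 4)).trans hζ
      have h2 := (abs_le.1 h1).1
      norm_num at h2
      linarith
    have hζ2 : ‖ζ‖ ≤ 1 / 2 := by
      have h1 := norm_add_le (ζ - 1 / 4) (1 / 4)
      rw [sub_add_cancel] at h1
      refine h1.trans ?_
      have : ‖(1 / 4 : ℂ)‖ = 1 / 4 := by norm_num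
      linarith
    have hn : 1 / 8 ≤ ‖ζ‖ := hre.trans (Complex.re_le_norm ζ)
    have hζ0 : ζ ≠ 0 := norm_pos_iff.1 (by linarith)
    have h1 := h ζ (by linarith) hζ2
    have h2 : ‖(b : ℂ) * Complex.exp (-ν * Complex.log ζ)‖ ≤ 64 * b₁ := by
      rw [norm_mul, norm_exp_neg_mul_log hζ0, Complex.norm_real, Real.norm_of_nonneg hbpos.le,
        mul_comm]
      refine mul_le_mul ?_ hb1 hbpos.le (by norm_num)
      calc ‖ζ‖ ^ (-ν) ≤ (1 / 8 : ℝ) ^ (-ν) :=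
            Real.rpow_le_rpow_of_nonpos (by norm_num) hn (by linarith)
        _ ≤ (1 / 8 : ℝ) ^ (-2 : ℝ) :=
            Real.rpow_le_rpow_of_exponent_ge (by norm_num) (by norm_num) (by linarith)
        _ = 64 := by norm_num [Real.rpow_neg]
    have h3 : (ζ.re ^ 2)⁻¹ ≤ 64 := by
      rw [inv_le_comm₀ (by positivity) (by norm_num)]
      nlinarith
    have h4 := norm_sub_le ((b : ℂ) * Complex.exp (-ν * Complex.log ζ) + F ζ)
      (b * Complex.exp (-ν * Complex.log ζ))
    rw [add_sub_cancel_left] at h4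
    nlinarith
  have hbig := hR p F _ hp hF hsmall (η : ℂ) (by
    rw [Complex.norm_real, Real.norm_of_nonneg hη0.le]
    exact hη1.le)
  have h1 := h η (by simpa using hη0) (by
    rw [Complex.norm_real, Real.norm_of_nonneg hη0.le]
    exact hη1.le)
  have h2 := norm_sub_le ((b : ℂ) * Complex.exp (-ν * Complex.log η) + F η) (F η)
  rw [add_sub_cancel_right, norm_mul, norm_exp_neg_mul_log (by exact_mod_cast hη0.ne'),
    Complex.norm_real, Complex.norm_real, Real.norm_of_nonneg hbpos.le,
    Real.norm_of_nonneg hη0.le] at h2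
  rw [Complex.ofReal_re] at h1
  have h3 : C * (64 * b₁) + 1 ≤ b * η ^ (-ν) := by
    rw [div_le_iff₀' hb₀] at hη
    refine hη.trans (mul_le_mul hb ?_ (by positivity) hbpos.le)
    exact Real.rpow_le_rpow_of_exponent_ge hη0 (by linarith) (by linarith)
  rw [inv_le_iff_one_le_mul₀ (by positivity)]
  nlinarith

/-! ### Laplace transforms of powers and of the kernels -/

lemma integrableOn_rpow_mul_exp_neg_mul {ν y : ℝ} (hν : 0 < ν) (hy : 0 < y) :
    IntegrableOn (fun x : ℝ => x ^ (ν - 1) * Real.exp (-(y * x))) (Ioi 0) := by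
  simpa using integrableOn_rpow_mul_exp_neg_mul_rpow (p := 1) (s := ν - 1) (b := y) (by linarith)
    one_pos hy

lemma norm_rpow_mul_cexp {x : ℝ} (hx : 0 < x) (ν : ℝ) (w : ℂ) :
    ‖((x ^ ν : ℝ) : ℂ) * Complex.exp (-(w * x))‖ = x ^ ν * Real.exp (-(w.re * x)) := by
  rw [norm_mul, Complex.norm_real, Real.norm_of_nonneg (by positivity), Complex.norm_exp]
  simp

lemma integrableOn_rpow_mul_cexp {ν : ℝ} (hν : 0 < ν) {w : ℂ} (hw : 0 < w.re) :
    IntegrableOn (fun x : ℝ => ((x ^ (ν - 1) : ℝ) : ℂ) * Complex.exp (-(w * x))) (Ioi 0) := by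
  refine (integrable_norm_iff ?_).1 ((integrableOn_rpow_mul_exp_neg_mul hν hw).congr ?_)
  · exact (by fun_prop : Measurable _).aestronglyMeasurable
  · filter_upwards [ae_restrict_mem measurableSet_Ioi] with x hx
    exact (norm_rpow_mul_cexp hx _ _).symm

/-- The integral `∫ x ^ (ν - 1) * exp (-w x) = Γ(ν) w ^ (-ν)` over `(0, ∞)`. -/
theorem integral_rpow_mul_cexp {ν : ℝ} (hν : 0 < ν) {w : ℂ} (hw : 0 < w.re) :
    ∫ x : ℝ in Ioi 0, ((x ^ (ν - 1) : ℝ) : ℂ) * Complex.exp (-(w * x)) =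
      Real.Gamma ν * Complex.exp (-ν * Complex.log w) := by
  let U : Set ℂ := {z | 0 < z.re}
  have hUo : IsOpen U := isOpen_lt continuous_const Complex.continuous_re
  have hUc : IsPreconnected U := (convex_halfSpace_re_gt 0).isPreconnected
  have hL : DifferentiableOn ℂ (fun w : ℂ =>
      ∫ x : ℝ in Ioi 0, ((x ^ (ν - 1) : ℝ) : ℂ) * Complex.exp (-(w * x))) U := by
    intro z hz
    have hz' : 0 < z.re := hz
    refine (HasDerivAt.differentiableAt (hasDerivAt_integral_of_dominated_loc_of_deriv_le
      (s := {u : ℂ | z.re / 2 < u.re})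
      (F' := fun u (x : ℝ) => ((x ^ (ν - 1) : ℝ) : ℂ) * (Complex.exp (-(u * x)) * -x))
      (bound := fun x => x ^ (ν + 1 - 1) * Real.exp (-(z.re / 2 * x)))
      ?_ ?_ ?_ ?_ ?_ ?_ ?_).2).differentiableWithinAt
    · exact (isOpen_lt continuous_const Complex.continuous_re).mem_nhds (half_lt_self hz')
    · exact .of_forall fun u => (by fun_prop : Measurable _).aestronglyMeasurable
    · exact integrableOn_rpow_mul_cexp hν hz'
    · exact (by fun_prop : Measurable _).aestronglyMeasurable
    · filter_upwards [ae_restrict_mem measurableSet_Ioi] with x hx u hu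
      have hx' : 0 < x := hx
      rw [← mul_assoc, norm_mul, norm_rpow_mul_cexp hx', norm_neg, Complex.norm_real,
        Real.norm_of_nonneg hx'.le, add_sub_cancel_right, mul_right_comm]
      nth_rewrite 2 [← Real.rpow_one x]
      rw [← Real.rpow_add hx', sub_add_cancel]
      have : z.re / 2 < u.re := hu
      gcongr
    · exact integrableOn_rpow_mul_exp_neg_mul (by linarith) (by linarith)
    · refine .of_forall fun x u _ => HasDerivAt.const_mul _ (HasDerivAt.cexp ?_)
      exact ((hasDerivAt_id u).mul_const (x : ℂ)).fun_neg.congr_deriv (by simp)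
  have hR : DifferentiableOn ℂ (fun w : ℂ =>
      (Real.Gamma ν : ℂ) * Complex.exp (-ν * Complex.log w)) U := by
    intro z hz
    have : z ∈ Complex.slitPlane := Or.inl hz
    exact ((((differentiableAt_id.clog this).const_mul _).cexp).const_mul
      _).differentiableWithinAt
  -- Identity theorem: both sides are holomorphic in the right half-plane, and they agree at
  -- positive reals accumulating at `1`.
  refine (hL.analyticOnNhd hUo).eqOn_of_preconnected_of_frequently_eq (hR.analyticOnNhd hUo) hUc
    (z₀ := 1) (by simp [U]) ?_ hw
  have hreal : ∀ y : ℝ, 0 < y →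
      ∫ x : ℝ in Ioi 0, ((x ^ (ν - 1) : ℝ) : ℂ) * Complex.exp (-((y : ℂ) * x)) =
        Real.Gamma ν * Complex.exp (-ν * Complex.log y) := by
    intro y hy
    have h1 := Real.integral_rpow_mul_exp_neg_mul_Ioi hν hy
    have h2 : (1 / y) ^ ν = Real.exp (-ν * Real.log y) := by
      rw [Real.rpow_def_of_pos (by positivity), one_div, Real.log_inv]
      ring_nf
    rw [h2] at h1
    have h3 := congrArg (fun t : ℝ => (t : ℂ)) h1
    simp only [← integral_complex_ofReal] at h3
    push_cast at h3
    rw [mul_comm, ← Complex.ofReal_log hy.le, ← h3]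
  have htend : Tendsto (fun m : ℕ => (((1 + 1 / ((m : ℝ) + 1) : ℝ)) : ℂ)) atTop (𝓝[≠] 1) := by
    refine tendsto_nhdsWithin_iff.2 ⟨?_, .of_forall fun m => ?_⟩
    · have h1 := (tendsto_one_div_add_atTop_nhds_zero_nat (𝕜 := ℝ)).const_add 1
      rw [add_zero] at h1
      exact (Complex.continuous_ofReal.tendsto 1).comp h1
    · have : (0 : ℝ) < 1 / ((m : ℝ) + 1) := by positivity
      intro h
      have h' : (1 + 1 / ((m : ℝ) + 1) : ℝ) = 1 := Complex.ofReal_eq_one.1 h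
      linarith
  exact htend.frequently (Frequently.of_forall fun m => hreal _ (by positivity))

lemma exists_Gamma_mem_Icc {ν₀ : ℝ} (hν₀ : 0 < ν₀) (ν₁ : ℝ) :
    ∃ b₀ b₁ : ℝ, 0 < b₀ ∧ ∀ ν ∈ Icc ν₀ ν₁, Real.Gamma ν ∈ Icc b₀ b₁ := by
  have hcont : ContinuousOn Real.Gamma (Icc ν₀ ν₁) := fun ν hν =>
    (Real.differentiableAt_Gamma fun m => by
      have := hν.1
      have : (0 : ℝ) ≤ m := m.cast_nonneg
      linarith).continuousAt.continuousWithinAt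
  by_cases h : ν₀ ≤ ν₁
  · obtain ⟨x, hx, hmin⟩ := isCompact_Icc.exists_isMinOn (nonempty_Icc.2 h) hcont
    obtain ⟨y, hy, hmax⟩ := isCompact_Icc.exists_isMaxOn (nonempty_Icc.2 h) hcont
    exact ⟨_, _, Real.Gamma_pos_of_pos (hν₀.trans_le hx.1), fun ν hν => ⟨hmin hν, hmax hν⟩⟩
  · exact ⟨1, 1, one_pos, fun ν hν => absurd (hν.1.trans hν.2) h⟩

/-- Hölder's inequality for the Laplace transform of `x * f x`. -/
lemma exists_norm_integral_mul_cexp_le {α : ℝ} (hα : 1 < α) :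
    ∃ C : ℝ, 0 < C ∧ ∀ (f : ℝ → ℂ) (w : ℂ), Measurable f → 0 < w.re →
      eLpNorm f (ENNReal.ofReal α) (volume.restrict (Ioi 0)) ≠ ⊤ →
      ‖∫ x : ℝ in Ioi 0, f x * (x * Complex.exp (-(w * x)))‖ ≤
        (eLpNorm f (ENNReal.ofReal α) (volume.restrict (Ioi 0))).toReal *
          (C * w.re ^ (-(2 - 1 / α))) := by
  have hα0 : 0 < α := by linarith
  obtain ⟨q, hpq⟩ : ∃ q, α.HolderConjugate q := ⟨_, Real.HolderConjugate.conjExponent hα⟩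
  have hq0 : 0 < q := hpq.symm.pos
  have hq : 1 / q = 1 - 1 / α := by
    have := hpq.inv_add_inv_eq_one
    rw [one_div, one_div]
    linarith
  have hint : ∀ y : ℝ, 0 < y → ∀ x : ℝ, 0 < x →
      (x * Real.exp (-(y * x))) ^ q = x ^ (q + 1 - 1) * Real.exp (-(q * y * x)) := by
    intro y _ x hx
    rw [Real.mul_rpow hx.le (Real.exp_pos _).le, ← Real.exp_mul, add_sub_cancel_right]
    ring_nf
  refine ⟨(q ^ (-(q + 1)) * Real.Gamma (q + 1)) ^ (1 / q),
    Real.rpow_pos_of_pos (mul_pos (by positivity) (Real.Gamma_pos_of_pos (by linarith))) _,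
    fun f w hf hw hfin => ?_⟩
  set g : ℝ → ℂ := fun x => x * Complex.exp (-(w * x)) with hgdef
  have hgm : Measurable g := by fun_prop
  have hgn : ∀ x : ℝ, 0 < x → ‖g x‖ ^ q = x ^ (q + 1 - 1) * Real.exp (-(q * w.re * x)) := by
    intro x hx
    rw [← hint w.re hw x hx]
    have := norm_rpow_mul_cexp hx 1 w
    rw [Real.rpow_one] at this
    rw [← this]
  have hgi : Integrable (fun x => ‖g x‖ ^ q) (volume.restrict (Ioi 0)) := by
    refine (integrableOn_rpow_mul_exp_neg_mul (ν := q + 1) (y := q * w.re) (by linarith)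
      (by positivity)).congr ?_
    filter_upwards [ae_restrict_mem measurableSet_Ioi] with x hx
    exact (hgn x hx).symm
  have hgL : MemLp g (ENNReal.ofReal q) (volume.restrict (Ioi 0)) := by
    refine (integrable_norm_rpow_iff hgm.aestronglyMeasurable (by simpa using hq0)
      ENNReal.ofReal_ne_top).1 ?_
    rwa [ENNReal.toReal_ofReal hq0.le]
  have hfL : MemLp f (ENNReal.ofReal α) (volume.restrict (Ioi 0)) :=
    ⟨hf.aestronglyMeasurable, hfin.lt_top⟩
  have hgnorm : (∫ x : ℝ in Ioi 0, ‖g x‖ ^ q) ^ (1 / q) =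
      (q ^ (-(q + 1)) * Real.Gamma (q + 1)) ^ (1 / q) * w.re ^ (-(2 - 1 / α)) := by
    rw [setIntegral_congr_fun measurableSet_Ioi fun x hx => hgn x hx,
      Real.integral_rpow_mul_exp_neg_mul_Ioi (by linarith) (by positivity), one_div (q * w.re),
      Real.inv_rpow (by positivity), ← Real.rpow_neg (by positivity),
      Real.mul_rpow hq0.le hw.le, mul_right_comm,
      Real.mul_rpow (mul_nonneg (by positivity) (Real.Gamma_pos_of_pos (by linarith)).le)
        (by positivity), ← Real.rpow_mul hw.le]
    congr 2
    have : -(q + 1) * (1 / q) = -1 - 1 / q := by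
      field_simp
      ring
    rw [this, hq]
    ring
  have hfnorm : (eLpNorm f (ENNReal.ofReal α) (volume.restrict (Ioi 0))).toReal =
      (∫ x : ℝ in Ioi 0, ‖f x‖ ^ α) ^ (1 / α) := by
    rw [hfL.eLpNorm_eq_integral_rpow_norm (by simpa using hα0) ENNReal.ofReal_ne_top,
      ENNReal.toReal_ofReal hα0.le, ENNReal.toReal_ofReal (by positivity), one_div]
  rw [hfnorm, ← hgnorm]
  refine (norm_integral_le_integral_norm _).trans ?_
  simp only [norm_mul]
  simpa only [norm_mul, hgdef] using integral_mul_norm_le_Lp_mul_Lq hpq hfL hgL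

lemma measurable_harmonizableKernel (α h t : ℝ) : Measurable (harmonizableKernel α h t) := by
  unfold harmonizableKernel
  fun_prop

/-- The extra factor `x` makes the power `x ^ (ν - 1)` with `ν = 2 - 1 / α - h`, which is positive
for `1 < α` and `h < 1`. The two exponentials can then be integrated separately; without it each may
diverge at the origin. -/
lemma harmonizableKernel_mul {α h t : ℝ} (w : ℂ) {x : ℝ} (hx : 0 < x) :
    harmonizableKernel α h t x * (x * Complex.exp (-(w * x))) =
      ((x ^ (2 - 1 / α - h - 1) : ℝ) : ℂ) * Complex.exp (-((w - Complex.I * t) * x)) -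
        ((x ^ (2 - 1 / α - h - 1) : ℝ) : ℂ) * Complex.exp (-(w * x)) := by
  have h1 : x ^ (2 - 1 / α - h - 1) = x / x ^ (1 / α + h) := by
    nth_rewrite 2 [← Real.rpow_one x]
    rw [← Real.rpow_sub hx]
    ring_nf
  have h2 : Complex.exp (-((w - Complex.I * t) * x)) =
      Complex.exp (Complex.I * ((t * x : ℝ) : ℂ)) * Complex.exp (-(w * x)) := by
    rw [← Complex.exp_add]
    push_cast
    ring_nf
  rw [harmonizableKernel, abs_of_pos hx, h1, h2]
  push_cast
  ring

lemma integrableOn_harmonizableKernel_mul {α h : ℝ} (t : ℝ) (hν : 0 < 2 - 1 / α - h)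
    {w : ℂ} (hw : 0 < w.re) :
    IntegrableOn (fun x : ℝ => harmonizableKernel α h t x * (x * Complex.exp (-(w * x))))
      (Ioi 0) := by
  have hw' : 0 < (w - Complex.I * t).re := by simpa using hw
  refine IntegrableOn.congr_fun ((integrableOn_rpow_mul_cexp hν hw').sub
    (integrableOn_rpow_mul_cexp hν hw)) (fun x hx => ?_) measurableSet_Ioi
  exact (harmonizableKernel_mul w hx).symm

lemma integral_harmonizableKernel_mul {α h : ℝ} (t : ℝ) (hν : 0 < 2 - 1 / α - h)
    {w : ℂ} (hw : 0 < w.re) :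
    ∫ x : ℝ in Ioi 0, harmonizableKernel α h t x * (x * Complex.exp (-(w * x))) =
      Real.Gamma (2 - 1 / α - h) *
        (Complex.exp (-((2 - 1 / α - h : ℝ) : ℂ) * Complex.log (w - Complex.I * t)) -
          Complex.exp (-((2 - 1 / α - h : ℝ) : ℂ) * Complex.log w)) := by
  have hw' : 0 < (w - Complex.I * t).re := by simpa using hw
  rw [setIntegral_congr_fun measurableSet_Ioi fun x hx => harmonizableKernel_mul w hx,
    integral_sub (integrableOn_rpow_mul_cexp hν hw') (integrableOn_rpow_mul_cexp hν hw),
    integral_rpow_mul_cexp hν hw', integral_rpow_mul_cexp hν hw, mul_sub]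

/-- The power `(i d + r ζ) ^ (-ν)` as a function of `ζ`. -/
lemma exp_neg_mul_log_add {k : ℕ} (p : Fin k → ℂ) (j : Fin k) {d r : ℝ} (hr : 0 < r) (hrd : r ≤ d)
    (hp : p j = r / (Complex.I * d)) (ν : ℝ) {ζ : ℂ} (hζ : ‖ζ‖ ≤ 1 / 2) :
    Complex.exp (-ν * Complex.log (Complex.I * d + r * ζ)) =
      Complex.exp (-ν * Complex.log (Complex.I * d)) * powProd p (Pi.single j (-ν)) ζ := by
  have hd : 0 < d := hr.trans_le hrd
  have hd' : (d : ℂ) ≠ 0 := by exact_mod_cast hd.ne'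
  have hpn : ‖p j‖ ≤ 1 := by
    rw [hp, norm_div, norm_mul, Complex.norm_I, one_mul, Complex.norm_real, Complex.norm_real,
      Real.norm_of_nonneg hr.le, Real.norm_of_nonneg hd.le]
    exact (div_le_one hd).2 hrd
  have hfac : Complex.I * d + r * ζ = Complex.I * d * (1 + p j * ζ) := by
    rw [hp]
    field_simp
  have hslit := one_add_mul_mem_slitPlane hpn (ζ := ζ) (hζ.trans_lt (by norm_num))
  have hre : 0 < (1 + p j * ζ).re := by
    have h1 := (Complex.abs_re_le_norm (p j * ζ)).trans (le_of_eq (norm_mul _ _))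
    have h2 := mul_le_mul hpn hζ (norm_nonneg _) zero_le_one
    have h3 := (abs_le.1 (h1.trans h2)).1
    rw [Complex.add_re, Complex.one_re]
    linarith
  have harg := abs_lt.1 (Complex.abs_arg_lt_pi_div_two_iff.2 (Or.inl hre))
  have hargI : (Complex.I * (d : ℂ)).arg = Real.pi / 2 := by
    rw [mul_comm, Complex.arg_real_mul _ hd, Complex.arg_I]
  -- The arguments are `π / 2` and something in `(-π / 2, π / 2)`, so their sum stays within the
  -- principal branch.
  have hlog : Complex.log (Complex.I * d + r * ζ) =
      Complex.log (Complex.I * d) + Complex.log (1 + p j * ζ) := by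
    rw [hfac]
    refine Complex.log_mul (mul_ne_zero Complex.I_ne_zero hd') (Complex.slitPlane_ne_zero hslit) ?_
    rw [hargI]
    exact ⟨by linarith [Real.pi_pos], by linarith⟩
  have hsum : ∑ i, ((Pi.single (M := fun _ => ℝ) j (-ν) i : ℝ) : ℂ) * Complex.log (1 + p i * ζ) =
      -ν * Complex.log (1 + p j * ζ) := by
    rw [Finset.sum_eq_single j]
    · simp
    · intro i _ hij
      simp [hij]
    · simp
  rw [hlog, powProd, hsum, ← Complex.exp_add, mul_add]

/-! ### Lower bound for the distance between kernels -/

/-- Lower bound for the distance in `L^α(0, ∞)` of a kernel to linear combinations of other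
kernels. -/
theorem exists_mul_rpow_le_eLpNorm_kernel {α : ℝ} (hα : 1 < α) {h₀ h₁ : ℝ} (hh₀ : 0 ≤ h₀)
    (hh₁ : h₁ < 1) (n : ℕ) :
    ∃ c : ℝ, 0 < c ∧ ∀ (h τ r : ℝ) (g t a : Fin n → ℝ), h ∈ Icc h₀ h₁ → (∀ k, g k ∈ Icc h₀ h₁) →
      0 < r → r ≤ τ → (∀ k, t k ≤ τ - r) → ∀ f : ℝ → ℂ,
      f = (fun x => harmonizableKernel α h τ x - ∑ k, a k * harmonizableKernel α (g k) (t k) x) →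
      eLpNorm f (ENNReal.ofReal α) (volume.restrict (Ioi 0)) ≠ ⊤ →
      c * r ^ h ≤ (eLpNorm f (ENNReal.ofReal α) (volume.restrict (Ioi 0))).toReal := by
  have hα' : 1 / α < 1 := (div_lt_one (by linarith)).2 hα
  have hα0 : 0 < 1 / α := by positivity
  obtain ⟨b₀, b₁, hb₀, hΓ⟩ := exists_Gamma_mem_Icc (ν₀ := 1 - h₁) (by linarith) 2
  -- The regular terms are one power of `w` from the kernel of `τ`, then for each of the other `n`
  -- kernels one power of `w - i t k` and one of `w`.
  obtain ⟨c, hc, hlow⟩ := exists_le_of_norm_add_isPowSum_le (n + 1)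
    ([1] ++ (List.replicate n 1 ++ List.replicate n 1)) (ν₀ := 1 - h₁) (b₁ := b₁) (by linarith) hb₀
  obtain ⟨C, hC, hhol⟩ := exists_norm_integral_mul_cexp_le hα
  refine ⟨c / C, by positivity, ?_⟩
  intro h τ r g t a hh hg hr hrτ ht f hf hfin
  have hν : ∀ s ∈ Icc h₀ h₁, 2 - 1 / α - s ∈ Icc (1 - h₁) 2 := fun s hs =>
    ⟨by linarith [hs.2], by linarith [hs.1]⟩
  have hν0 : ∀ s ∈ Icc h₀ h₁, 0 < 2 - 1 / α - s := fun s hs => by linarith [(hν s hs).1]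
  set N := (eLpNorm f (ENNReal.ofReal α) (volume.restrict (Ioi 0))).toReal
  set ν := 2 - 1 / α - h with hνdef
  -- Index `0` encodes the singularity `w = 0`, at distance `τ` from `iτ`; the others encode `i t
  -- k`, at distance `τ - t k`. All distances are at least `r`, hence `‖p i‖ ≤ 1`.
  set p : Fin (n + 1) → ℂ :=
    Fin.cons (r / (Complex.I * τ)) fun k => r / (Complex.I * ((τ - t k : ℝ) : ℂ)) with hpdef
  have hp0 : p 0 = r / (Complex.I * τ) := rfl
  have hps : ∀ k : Fin n, p k.succ = r / (Complex.I * ((τ - t k : ℝ) : ℂ)) := fun k => rfl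
  have hnorm : ∀ d : ℝ, r ≤ d → ‖(r : ℂ) / (Complex.I * d)‖ ≤ 1 := fun d hd => by
    rw [norm_div, norm_mul, Complex.norm_I, one_mul, Complex.norm_real, Complex.norm_real,
      Real.norm_of_nonneg hr.le, Real.norm_of_nonneg (hr.le.trans hd)]
    exact (div_le_one (hr.trans_le hd)).2 hd
  have hp : ∀ i, ‖p i‖ ≤ 1 := by
    intro i
    refine Fin.cases ?_ (fun k => ?_) i
    · exact hnorm τ hrτ
    · rw [hps]
      exact hnorm _ (by linarith [ht k])
  have hsingle : ∀ (j : Fin (n + 1)) (s : ℝ), s ∈ Icc h₀ h₁ →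
      ∀ i, |Pi.single (M := fun _ => ℝ) j (-(2 - 1 / α - s)) i| ≤ 2 := by
    intro j s hs i
    by_cases hij : i = j
    · subst hij
      rw [Pi.single_eq_same, abs_neg, abs_of_pos (hν0 s hs)]
      exact (hν s hs).2
    · simp [hij]
  set e : ℝ → ℝ → ℂ := fun s d =>
    Complex.exp (-((2 - 1 / α - s : ℝ) : ℂ) * Complex.log (Complex.I * d)) with hedef
  set F₀ : ℂ → ℂ := fun ζ => (-(r ^ ν : ℝ) * Real.Gamma ν * e h τ : ℂ) *
    powProd p (Pi.single 0 (-ν)) ζ with hF₀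
  set F₁ : Fin n → ℂ → ℂ := fun k ζ =>
    (-(r ^ ν : ℝ) * a k * Real.Gamma (2 - 1 / α - g k) * e (g k) (τ - t k) : ℂ) *
    powProd p (Pi.single k.succ (-(2 - 1 / α - g k))) ζ with hF₁
  set F₂ : Fin n → ℂ → ℂ := fun k ζ =>
    ((r ^ ν : ℝ) * a k * Real.Gamma (2 - 1 / α - g k) * e (g k) τ : ℂ) *
    powProd p (Pi.single 0 (-(2 - 1 / α - g k))) ζ with hF₂
  have hF : IsPowSum p 2 ([1] ++ (List.replicate n 1 ++ List.replicate n 1))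
      (F₀ + (∑ k, F₁ k + ∑ k, F₂ k)) :=
    (IsPowSum.const_mul_powProd (hsingle 0 h hh) _).add
      ((IsPowSum.sum fun k => .const_mul_powProd (hsingle _ _ (hg k)) _).add
        (IsPowSum.sum fun k => .const_mul_powProd (hsingle _ _ (hg k)) _))
  have hfm : Measurable f := by
    rw [hf]
    exact (measurable_harmonizableKernel _ _ _).sub (Finset.measurable_fun_sum _ fun k _ =>
      (measurable_harmonizableKernel _ _ _).const_mul _)
  have key := hlow p _ ν (Real.Gamma ν) (N * C * r ^ (-h)) hp hF (hν h hh) (hΓ _ (hν h hh)) ?_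
  · rw [div_mul_eq_mul_div, div_le_iff₀ hC]
    have : r ^ (-h) * r ^ h = 1 := by
      rw [← Real.rpow_add hr, neg_add_cancel, Real.rpow_zero]
    calc c * r ^ h ≤ N * C * r ^ (-h) * r ^ h := by gcongr
      _ = N * C := by rw [mul_assoc, this, mul_one]
  intro ζ hζ hζ'
  -- Zoom in on the singularity `iτ` at scale `r`. Multiplication by `r ^ ν` later normalises
  -- `(rζ)^(-ν)` to `ζ^(-ν)` and turns the Hölder factor `r ^ (-(2 - 1 / α))` into `r ^ (-h)`.
  set w : ℂ := Complex.I * τ + r * ζ with hw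
  have hwre : w.re = r * ζ.re := by simp [hw]
  have hwpos : 0 < w.re := by rw [hwre]; positivity
  have hI : ∫ x : ℝ in Ioi 0, f x * (x * Complex.exp (-(w * x))) =
      Real.Gamma ν * (Complex.exp (-ν * Complex.log (r * ζ)) -
        e h τ * powProd p (Pi.single 0 (-ν)) ζ) -
      ∑ k, a k * (Real.Gamma (2 - 1 / α - g k) *
        (e (g k) (τ - t k) * powProd p (Pi.single k.succ (-(2 - 1 / α - g k))) ζ -
          e (g k) τ * powProd p (Pi.single 0 (-(2 - 1 / α - g k))) ζ)) := by
    have h1 : ∀ x : ℝ, f x * (x * Complex.exp (-(w * x))) =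
        harmonizableKernel α h τ x * (x * Complex.exp (-(w * x))) -
        ∑ k, a k * (harmonizableKernel α (g k) (t k) x * (x * Complex.exp (-(w * x)))) := by
      intro x
      rw [hf]
      simp only [sub_mul, Finset.sum_mul, mul_assoc]
    simp only [h1]
    rw [integral_sub (integrableOn_harmonizableKernel_mul τ (hν0 h hh) hwpos)
      (integrable_finsetSum _ fun k _ =>
        (integrableOn_harmonizableKernel_mul (t k) (hν0 _ (hg k)) hwpos).const_mul _),
      integral_finsetSum _ fun k _ =>
        (integrableOn_harmonizableKernel_mul (t k) (hν0 _ (hg k)) hwpos).const_mul _]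
    simp only [integral_const_mul]
    rw [integral_harmonizableKernel_mul τ (hν0 h hh) hwpos]
    have h2 : w - Complex.I * τ = r * ζ := by
      rw [hw]
      ring
    have h3 : ∀ s, Complex.exp (-((2 - 1 / α - s : ℝ) : ℂ) * Complex.log w) =
        e s τ * powProd p (Pi.single 0 (-(2 - 1 / α - s))) ζ := fun s =>
      exp_neg_mul_log_add p 0 hr hrτ hp0 _ hζ'
    rw [h2, h3 h]
    congr 1
    refine Finset.sum_congr rfl fun k _ => ?_
    have h4 : w - Complex.I * t k = Complex.I * ((τ - t k : ℝ) : ℂ) + r * ζ := by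
      rw [hw]
      push_cast
      ring
    rw [integral_harmonizableKernel_mul (t k) (hν0 _ (hg k)) hwpos, h3 (g k), h4,
      exp_neg_mul_log_add p k.succ hr (by linarith [ht k]) (hps k) _ hζ']
  have hscale : ((r ^ ν : ℝ) : ℂ) * Complex.exp (-ν * Complex.log (r * ζ)) =
      Complex.exp (-ν * Complex.log ζ) := by
    have hζ0 : ζ ≠ 0 := fun h0 => by simp [h0] at hζ
    rw [Complex.log_ofReal_mul hr hζ0, mul_add, Complex.exp_add, ← mul_assoc,
      Real.rpow_def_of_pos hr, Complex.ofReal_exp, ← Complex.exp_add]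
    have : ((Real.log r * ν : ℝ) : ℂ) + -(ν : ℂ) * (Real.log r : ℂ) = 0 := by
      push_cast
      ring
    rw [this, Complex.exp_zero, one_mul]
  have heq : Real.Gamma ν * Complex.exp (-ν * Complex.log ζ) + (F₀ + (∑ k, F₁ k + ∑ k, F₂ k)) ζ =
      ((r ^ ν : ℝ) : ℂ) * ∫ x : ℝ in Ioi 0, f x * (x * Complex.exp (-(w * x))) := by
    rw [hI, ← hscale]
    simp only [Pi.add_apply, Finset.sum_apply, hF₀, hF₁, hF₂]
    rw [← Finset.sum_add_distrib, mul_sub, Finset.mul_sum, sub_eq_add_neg _ (Finset.sum _ _),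
      ← Finset.sum_neg_distrib, ← add_assoc]
    congr 1
    · ring
    · refine Finset.sum_congr rfl fun k _ => ?_
      ring
  rw [heq, norm_mul, Complex.norm_real, Real.norm_of_nonneg (by positivity)]
  have hζ1 : ζ.re ≤ 1 := (Complex.re_le_norm ζ).trans (by linarith)
  calc r ^ ν * ‖∫ x : ℝ in Ioi 0, f x * (x * Complex.exp (-(w * x)))‖
      ≤ r ^ ν * (N * (C * w.re ^ (-(2 - 1 / α)))) := by
        gcongr
        exact hhol f w hfm hwpos hfin
    _ = N * C * (r ^ ν * r ^ (-(2 - 1 / α))) * ζ.re ^ (-(2 - 1 / α)) := by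
        rw [hwre, Real.mul_rpow hr.le hζ.le]
        ring
    _ = N * C * r ^ (-h) * ζ.re ^ (-(2 - 1 / α)) := by
        rw [← Real.rpow_add hr, hνdef]
        ring_nf
    _ ≤ N * C * r ^ (-h) * (ζ.re ^ 2)⁻¹ := by
        have hN : 0 ≤ N := ENNReal.toReal_nonneg
        gcongr
        rw [← Real.rpow_natCast, ← Real.rpow_neg hζ.le]
        exact Real.rpow_le_rpow_of_exponent_ge hζ hζ1 (by push_cast; linarith)

/-! ### Upper bound for the increments of the kernels -/

lemma abs_exp_sub_exp_le (u v : ℝ) :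
    |Real.exp u - Real.exp v| ≤ |u - v| * max (Real.exp u) (Real.exp v) := by
  wlog h : v ≤ u generalizing u v
  · rw [abs_sub_comm, abs_sub_comm u, max_comm]
    exact this v u (le_of_not_ge h)
  have h1 := Real.add_one_le_exp (v - u)
  have h2 : Real.exp v = Real.exp u * Real.exp (v - u) := by
    rw [← Real.exp_add]
    ring_nf
  rw [abs_of_nonneg (sub_nonneg.2 (Real.exp_le_exp.2 h)), abs_of_nonneg (sub_nonneg.2 h),
    max_eq_left (Real.exp_le_exp.2 h)]
  nlinarith [Real.exp_pos u]

lemma abs_log_le_inv_rpow_div {x ε : ℝ} (hx : 0 < x) (hx1 : x ≤ 1) (hε : 0 < ε) :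
    |Real.log x| ≤ x ^ (-ε) / ε := by
  rw [abs_of_nonpos (Real.log_nonpos hx.le hx1), ← Real.log_inv, Real.rpow_neg hx.le,
    ← Real.inv_rpow hx.le]
  exact Real.log_le_rpow_div (by positivity) hε

/-- Lipschitz continuity of `h ↦ x ^ (-h)` with an integrable bound. -/
lemma abs_rpow_sub_rpow_le {x h₀ h₁ δ : ℝ} (hx : 0 < x) (hδ : 0 < δ) {h h' : ℝ}
    (hh : h ∈ Icc h₀ h₁) (hh' : h' ∈ Icc h₀ h₁) :
    |x ^ (-h) - x ^ (-h')| ≤ |h - h'| * (δ⁻¹ * (x ^ (-(h₀ - δ)) + x ^ (-(h₁ + δ)))) := by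
  have h1 := abs_exp_sub_exp_le (Real.log x * -h) (Real.log x * -h')
  rw [← Real.rpow_def_of_pos hx, ← Real.rpow_def_of_pos hx, ← mul_sub, abs_mul,
    show -h - -h' = -(h - h') by ring, abs_neg, mul_comm |Real.log x|, mul_assoc] at h1
  refine h1.trans (mul_le_mul_of_nonneg_left ?_ (abs_nonneg _))
  have ha : 0 < x ^ (-(h₀ - δ)) := by positivity
  have hb : 0 < x ^ (-(h₁ + δ)) := by positivity
  -- The logarithm costs a power `δ`: the exponent `h₁` dominates near `0`, and `h₀` at infinity.
  rcases le_total x 1 with hx1 | hx1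
  · have hmax : max (x ^ (-h)) (x ^ (-h')) ≤ x ^ (-h₁) :=
      max_le (Real.rpow_le_rpow_of_exponent_ge hx hx1 (neg_le_neg hh.2))
        (Real.rpow_le_rpow_of_exponent_ge hx hx1 (neg_le_neg hh'.2))
    calc |Real.log x| * max (x ^ (-h)) (x ^ (-h')) ≤ x ^ (-δ) / δ * x ^ (-h₁) := by
          gcongr
          exact abs_log_le_inv_rpow_div hx hx1 hδ
      _ = δ⁻¹ * x ^ (-(h₁ + δ)) := by
          rw [neg_add, Real.rpow_add hx]
          ring
      _ ≤ _ := by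
          gcongr
          linarith
  · have hmax : max (x ^ (-h)) (x ^ (-h')) ≤ x ^ (-h₀) :=
      max_le (Real.rpow_le_rpow_of_exponent_le hx1 (neg_le_neg hh.1))
        (Real.rpow_le_rpow_of_exponent_le hx1 (neg_le_neg hh'.1))
    calc |Real.log x| * max (x ^ (-h)) (x ^ (-h')) ≤ x ^ δ / δ * x ^ (-h₀) := by
          gcongr
          rw [abs_of_nonneg (Real.log_nonneg hx1)]
          exact Real.log_le_rpow_div hx.le hδ
      _ = δ⁻¹ * x ^ (-(h₀ - δ)) := by
          rw [neg_sub, sub_eq_add_neg, Real.rpow_add hx]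
          ring
      _ ≤ _ := by
          gcongr
          linarith

lemma norm_exp_I_mul_sub_one_le_min (θ : ℝ) :
    ‖Complex.exp (Complex.I * θ) - 1‖ ≤ min |θ| 2 := by
  refine le_min (Real.norm_exp_I_mul_ofReal_sub_one_le) ((norm_sub_le _ _).trans ?_)
  rw [mul_comm, Complex.norm_exp_ofReal_mul_I, norm_one]
  norm_num

/-- The function `min x 2 * x ^ (-(1 / α + h))`, which bounds the kernels. -/
def kernelBound (α h x : ℝ) : ℝ := min x 2 * x ^ (-(1 / α + h))

lemma kernelBound_nonneg (α h : ℝ) {x : ℝ} (hx : 0 ≤ x) : 0 ≤ kernelBound α h x :=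
  mul_nonneg (le_min hx zero_le_two) (by positivity)

lemma measurable_kernelBound (α h : ℝ) : Measurable (kernelBound α h) := by
  unfold kernelBound
  fun_prop

/-- Up to constants the `α`-th power is `x ^ (α * (1 - h) - 1)` near `0` and `x ^ (-1 - α * h)` at
infinity; `h < 1` and `0 < h` give integrability there. -/
lemma memLp_kernelBound {α h : ℝ} (hα : 0 < α) (hh₀ : 0 < h) (hh₁ : h < 1) :
    MemLp (kernelBound α h) (ENNReal.ofReal α) (volume.restrict (Ioi 0)) := by
  have hm := measurable_kernelBound α h
  refine (integrable_norm_rpow_iff hm.aestronglyMeasurable (by simpa using hα)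
    ENNReal.ofReal_ne_top).1 ?_
  rw [ENNReal.toReal_ofReal hα.le]
  have hm' : ∀ s : Set ℝ,
      AEStronglyMeasurable (fun x => ‖kernelBound α h x‖ ^ α) (volume.restrict s) := fun s =>
    (hm.norm.pow_const _).aestronglyMeasurable
  have heq : ∀ x : ℝ, 0 < x → ‖kernelBound α h x‖ ^ α = min x 2 ^ α * x ^ (-1 - α * h) := by
    intro x hx
    rw [Real.norm_of_nonneg (kernelBound_nonneg _ _ hx.le), kernelBound,
      Real.mul_rpow (by positivity) (by positivity), ← Real.rpow_mul hx.le]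
    congr 2
    field_simp
    ring
  change IntegrableOn _ _ _
  rw [← Ioc_union_Ioi_eq_Ioi (zero_le_one' ℝ)]
  refine IntegrableOn.union ?_ ?_
  · have hi : IntegrableOn (fun x : ℝ => x ^ (α * (1 - h) - 1)) (Ioc 0 1) :=
      (intervalIntegrable_iff_integrableOn_Ioc_of_le zero_le_one).1
        (intervalIntegral.intervalIntegrable_rpow' (by nlinarith))
    refine Integrable.mono' hi (hm' _) ?_
    filter_upwards [ae_restrict_mem measurableSet_Ioc] with x hx
    have hx0 : 0 < x := hx.1
    rw [Real.norm_of_nonneg (by positivity), heq x hx0]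
    calc min x 2 ^ α * x ^ (-1 - α * h) ≤ x ^ α * x ^ (-1 - α * h) := by
          gcongr
          exact min_le_left _ _
      _ = x ^ (α * (1 - h) - 1) := by
          rw [← Real.rpow_add hx0]
          ring_nf
  · have hi : IntegrableOn (fun x : ℝ => 2 ^ α * x ^ (-1 - α * h)) (Ioi 1) :=
      (integrableOn_Ioi_rpow_of_lt (by nlinarith) one_pos).const_mul _
    refine Integrable.mono' hi (hm' _) ?_
    filter_upwards [ae_restrict_mem measurableSet_Ioi] with x hx
    have hx0 : 0 < x := zero_lt_one.trans hx
    rw [Real.norm_of_nonneg (by positivity), heq x hx0]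
    gcongr
    exact min_le_right _ _

lemma eLpNorm_comp_mul_left_Ioi {g : ℝ → ℝ} {α : ℝ} (hα : 0 < α)
    (hg : MemLp g (ENNReal.ofReal α) (volume.restrict (Ioi 0))) (hgm : Measurable g) {r : ℝ}
    (hr : 0 < r) :
    eLpNorm (fun x => g (r * x)) (ENNReal.ofReal α) (volume.restrict (Ioi 0)) =
      ENNReal.ofReal (r ^ (-(1 / α)) *
        (eLpNorm g (ENNReal.ofReal α) (volume.restrict (Ioi 0))).toReal) := by
  have hp0 : ENNReal.ofReal α ≠ 0 := by simpa using hα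
  have hi := hg.integrable_norm_rpow hp0 ENNReal.ofReal_ne_top
  rw [ENNReal.toReal_ofReal hα.le] at hi
  have hi' : Integrable (fun x => ‖g (r * x)‖ ^ α) (volume.restrict (Ioi 0)) := by
    refine (integrableOn_Ioi_comp_mul_left_iff (fun x => ‖g x‖ ^ α) 0 hr).2 ?_
    rwa [mul_zero]
  have hg' : MemLp (fun x => g (r * x)) (ENNReal.ofReal α) (volume.restrict (Ioi 0)) := by
    refine (integrable_norm_rpow_iff
      (hgm.comp (measurable_const_mul r)).aestronglyMeasurable hp0 ENNReal.ofReal_ne_top).1 ?_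
    rwa [ENNReal.toReal_ofReal hα.le]
  rw [hg'.eLpNorm_eq_integral_rpow_norm hp0 ENNReal.ofReal_ne_top,
    hg.eLpNorm_eq_integral_rpow_norm hp0 ENNReal.ofReal_ne_top,
    ENNReal.toReal_ofReal hα.le, ENNReal.toReal_ofReal (by positivity)]
  have := integral_comp_mul_left_Ioi (fun x => ‖g x‖ ^ α) 0 hr
  rw [mul_zero] at this
  rw [this, smul_eq_mul, Real.mul_rpow (by positivity) (by positivity), Real.inv_rpow hr.le,
    ← Real.rpow_neg hr.le, one_div]

/-- Upper bound for increments of the kernels. -/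
theorem exists_eLpNorm_kernel_sub_le {α : ℝ} (hα : 1 < α) {h₀ h₁ : ℝ} (hh₀ : 0 < h₀)
    (hh₁ : h₁ < 1) (T : ℝ) :
    ∃ C : ℝ, 0 < C ∧ ∀ h h' s t : ℝ, h ∈ Icc h₀ h₁ → h' ∈ Icc h₀ h₁ → 0 ≤ s → s ≤ T → s < t →
      eLpNorm (fun x => harmonizableKernel α h t x - harmonizableKernel α h' s x)
        (ENNReal.ofReal α) (volume.restrict (Ioi 0)) ≤
          ENNReal.ofReal (C * ((t - s) ^ h + |h - h'|)) := by
  have hα0 : 0 < α := by linarith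
  -- The widened exponents `h₀ - δ` and `h₁ + δ` must stay in `(0, 1)`, so that `W` is in `L^α`.
  obtain ⟨δ, hδ, hδ₀, hδ₁⟩ : ∃ δ, 0 < δ ∧ δ < h₀ ∧ δ < 1 - h₁ := by
    obtain ⟨δ, hδ, h⟩ := exists_between (lt_min hh₀ (sub_pos.2 hh₁))
    exact ⟨δ, hδ, (lt_min_iff.1 h).1, (lt_min_iff.1 h).2⟩
  by_cases hle : h₀ ≤ h₁
  swap
  · exact ⟨1, one_pos, fun h h' s t hh => absurd (hh.1.trans hh.2) hle⟩
  set W : ℝ → ℝ := fun x => kernelBound α (h₀ - δ) x + kernelBound α (h₁ + δ) x with hW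
  have hWL : MemLp W (ENNReal.ofReal α) (volume.restrict (Ioi 0)) :=
    (memLp_kernelBound hα0 (by linarith) (by linarith)).add
      (memLp_kernelBound hα0 (by linarith) (by linarith))
  have hWm : Measurable W := (measurable_kernelBound _ _).add (measurable_kernelBound _ _)
  have hWf : ∀ x, 0 < x → W x = min x 2 * x ^ (-(1 / α)) * (x ^ (-(h₀ - δ)) + x ^ (-(h₁ + δ))) := by
    intro x hx
    simp only [hW, kernelBound, neg_add (1 / α), Real.rpow_add hx]
    ring
  set N := (eLpNorm W (ENNReal.ofReal α) (volume.restrict (Ioi 0))).toReal with hN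
  have hN0 : 0 ≤ N := ENNReal.toReal_nonneg
  refine ⟨(1 + (1 + |T|) * δ⁻¹) * (N + 1), by positivity, ?_⟩
  intro h h' s t hh hh' hs hsT hst
  set r := t - s with hr
  have hr0 : 0 < r := sub_pos.2 hst
  have hpt : ∀ x : ℝ, 0 < x → ‖harmonizableKernel α h t x - harmonizableKernel α h' s x‖ ≤
      ‖r ^ (1 / α + h) * W (r * x) + (1 + |T|) * δ⁻¹ * |h - h'| * W x‖ := by
    intro x hx
    have hrx : 0 < r * x := by positivity
    -- First change the time with the exponent `h` fixed, then the exponent at time `s`. The first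
    -- part scales to `r ^ (1 / α + h) * r ^ (-(1 / α)) = r ^ h`; the second is Lipschitz in the
    -- exponent.
    have hsplit : harmonizableKernel α h t x - harmonizableKernel α h' s x =
        Complex.exp (Complex.I * ((s * x : ℝ) : ℂ)) *
          (Complex.exp (Complex.I * ((r * x : ℝ) : ℂ)) - 1) * ((x ^ (-(1 / α + h)) : ℝ) : ℂ) +
        (Complex.exp (Complex.I * ((s * x : ℝ) : ℂ)) - 1) *
          ((x ^ (-(1 / α)) * (x ^ (-h) - x ^ (-h')) : ℝ) : ℂ) := by
      have h1 : Complex.exp (Complex.I * ((t * x : ℝ) : ℂ)) =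
          Complex.exp (Complex.I * ((s * x : ℝ) : ℂ)) *
            Complex.exp (Complex.I * ((r * x : ℝ) : ℂ)) := by
        rw [← Complex.exp_add, hr]
        push_cast
        ring_nf
      have h2 : ∀ u, ((x ^ (-(1 / α)) * x ^ (-u) : ℝ) : ℂ) =
          (((x ^ (1 / α + u) : ℝ) : ℂ))⁻¹ := fun u => by
        rw [← Real.rpow_add hx, ← neg_add, Real.rpow_neg hx.le,
          Complex.ofReal_inv]
      rw [harmonizableKernel, harmonizableKernel, abs_of_pos hx, h1, Real.rpow_neg hx.le,
        mul_sub (x ^ (-(1 / α))), Complex.ofReal_sub, h2, h2,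
        Complex.ofReal_inv]
      ring
    have hA : ‖Complex.exp (Complex.I * ((s * x : ℝ) : ℂ)) *
        (Complex.exp (Complex.I * ((r * x : ℝ) : ℂ)) - 1) * ((x ^ (-(1 / α + h)) : ℝ) : ℂ)‖ ≤
        r ^ (1 / α + h) * W (r * x) := by
      have h1 := norm_exp_I_mul_sub_one_le_min (r * x)
      rw [abs_of_pos hrx] at h1
      have h2 : x ^ (-(1 / α + h)) = r ^ (1 / α + h) * (r * x) ^ (-(1 / α + h)) := by
        rw [Real.mul_rpow hr0.le hx.le, ← mul_assoc, ← Real.rpow_add hr0, add_neg_cancel,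
          Real.rpow_zero, one_mul]
      have h3 : (r * x) ^ (-h) ≤ (r * x) ^ (-(h₀ - δ)) + (r * x) ^ (-(h₁ + δ)) := by
        rcases le_total (r * x) 1 with h4 | h4
        · have := Real.rpow_le_rpow_of_exponent_ge hrx h4
            (show -(h₁ + δ) ≤ -h by linarith [hh.2])
          have : 0 < (r * x) ^ (-(h₀ - δ)) := by positivity
          linarith
        · have := Real.rpow_le_rpow_of_exponent_le h4
            (show -h ≤ -(h₀ - δ) by linarith [hh.1])
          have : 0 < (r * x) ^ (-(h₁ + δ)) := by positivity
          linarith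
      rw [norm_mul, norm_mul, Complex.norm_real, Real.norm_of_nonneg (by positivity),
        mul_comm Complex.I ((s * x : ℝ) : ℂ), Complex.norm_exp_ofReal_mul_I, one_mul, h2,
        hWf _ hrx, neg_add, Real.rpow_add hrx]
      calc _ ≤ min (r * x) 2 * (r ^ (1 / α + h) * ((r * x) ^ (-(1 / α)) *
            ((r * x) ^ (-(h₀ - δ)) + (r * x) ^ (-(h₁ + δ))))) := by gcongr
        _ = _ := by ring
    have hB : ‖(Complex.exp (Complex.I * ((s * x : ℝ) : ℂ)) - 1) *
        ((x ^ (-(1 / α)) * (x ^ (-h) - x ^ (-h')) : ℝ) : ℂ)‖ ≤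
        (1 + |T|) * δ⁻¹ * |h - h'| * W x := by
      have h1 := norm_exp_I_mul_sub_one_le_min (s * x)
      rw [abs_of_nonneg (by positivity)] at h1
      have h2 : min (s * x) 2 ≤ (1 + |T|) * min x 2 := by
        have hT : s ≤ |T| := hsT.trans (le_abs_self T)
        have hT0 : 0 ≤ |T| := abs_nonneg T
        rcases le_total x 2 with hx2 | hx2
        · rw [min_eq_left hx2]
          exact (min_le_left _ _).trans (by nlinarith)
        · rw [min_eq_right hx2]
          exact (min_le_right _ _).trans (by nlinarith)
      have h3 := abs_rpow_sub_rpow_le hx hδ hh hh'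
      rw [norm_mul, Complex.norm_real, Real.norm_eq_abs, abs_mul,
        abs_of_nonneg (by positivity : 0 ≤ x ^ (-(1 / α))), hWf _ hx]
      calc _ ≤ (1 + |T|) * min x 2 * (x ^ (-(1 / α)) *
            (|h - h'| * (δ⁻¹ * (x ^ (-(h₀ - δ)) + x ^ (-(h₁ + δ)))))) := by
            gcongr
            exact h1.trans h2
        _ = _ := by ring
    rw [hsplit]
    exact (norm_add_le _ _).trans ((add_le_add hA hB).trans (le_abs_self _))
  have hα1 : 1 ≤ ENNReal.ofReal α := by simpa using hα.le
  have hW' : eLpNorm W (ENNReal.ofReal α) (volume.restrict (Ioi 0)) = ENNReal.ofReal N :=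
    (ENNReal.ofReal_toReal hWL.2.ne).symm
  have hmono : eLpNorm (fun x => harmonizableKernel α h t x - harmonizableKernel α h' s x)
      (ENNReal.ofReal α) (volume.restrict (Ioi 0)) ≤
      eLpNorm (fun x => r ^ (1 / α + h) * W (r * x) + (1 + |T|) * δ⁻¹ * |h - h'| * W x)
        (ENNReal.ofReal α) (volume.restrict (Ioi 0)) := by
    refine eLpNorm_mono_ae ?_
    filter_upwards [ae_restrict_mem measurableSet_Ioi] with x hx
    exact hpt x hx
  refine hmono.trans ?_
  have hWrm : Measurable fun x => W (r * x) := hWm.comp (measurable_const_mul r)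
  refine (eLpNorm_add_le (f := fun x => r ^ (1 / α + h) * W (r * x))
    (g := fun x => (1 + |T|) * δ⁻¹ * |h - h'| * W x) (hWrm.const_mul _).aestronglyMeasurable
    (hWm.const_mul _).aestronglyMeasurable hα1).trans ?_
  have hsm : ∀ (a : ℝ) (g : ℝ → ℝ), 0 ≤ a →
      eLpNorm (fun x => a * g x) (ENNReal.ofReal α) (volume.restrict (Ioi 0)) =
        ENNReal.ofReal a * eLpNorm g (ENNReal.ofReal α) (volume.restrict (Ioi 0)) := by
    intro a g ha
    rw [← Real.enorm_of_nonneg ha]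
    exact eLpNorm_const_smul a g _ _
  rw [hsm _ (fun x => W (r * x)) (by positivity), hsm _ W (by positivity),
    eLpNorm_comp_mul_left_Ioi hα0 hWL hWm hr0, hW', ENNReal.toReal_ofReal hN0,
    ← ENNReal.ofReal_mul (by positivity), ← ENNReal.ofReal_mul (by positivity),
    ← ENNReal.ofReal_add (by positivity) (by positivity)]
  refine ENNReal.ofReal_le_ofReal ?_
  rw [← mul_assoc, ← Real.rpow_add hr0, show 1 / α + h + -(1 / α) = h by ring]
  have hrh : 0 ≤ r ^ h := by positivity
  have hc : 0 ≤ (1 + |T|) * δ⁻¹ := by positivity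
  have hd := abs_nonneg (h - h')
  nlinarith [mul_nonneg hrh hc, mul_nonneg hd hc, mul_nonneg hrh hN0, mul_nonneg hd hN0,
    mul_nonneg (mul_nonneg hrh hc) hN0, mul_nonneg (mul_nonneg hd hc) hN0]

/-! ### Local nondeterminism -/

theorem mainTheorem1 {Ω : Type*} [MeasurableSpace Ω] (P : Measure Ω) [IsProbabilityMeasure P]
    (α : ℝ) (hα : 1 < α) (hα' : α < 2)
    (M : Set ℝ → Ω → ℂ) (hM : IsHermitianStableMeasure α P M)
    (H : ℝ → ℝ) (Hinf Hsup : ℝ)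
    (hHinf : IsGLB (H '' Ici 0) Hinf) (hHsup : IsLUB (H '' Ici 0) Hsup)
    (hHinf_pos : 0 < Hinf) (hHsup_lt : Hsup < 1)
    (γ K : ℝ) (hγ : Hsup < γ)
    (hHolder : ∀ s t : ℝ, 0 ≤ s → 0 ≤ t → |H t - H s| ≤ K * |t - s| ^ γ)
    (X : ℝ → Ω → ℝ) (hX : IsRHMSP α H P M X)
    (T ε : ℝ) (hε : 0 < ε) :
    IsLND α P X (Icc ε T) := by
  have hH : ∀ t, 0 ≤ t → H t ∈ Icc Hinf Hsup := fun t ht =>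
    ⟨hHinf.1 (mem_image_of_mem H ht), hHsup.1 (mem_image_of_mem H ht)⟩
  have hpos : ∀ t ∈ Icc ε T, 0 < t := fun t ht => hε.trans_le ht.1
  have hcomb : ∀ (n : ℕ) (τ : ℝ) (t a : Fin n → ℝ), 0 ≤ τ → (∀ k, 0 ≤ t k) →
      eLpNorm (fun x => harmonizableKernel α (H τ) τ x -
        ∑ k, a k * harmonizableKernel α (H (t k)) (t k) x) (ENNReal.ofReal α)
          (volume.restrict (Ioi 0)) ≠ ⊤ ∧
      stableNorm α P (X τ - ∑ k, a k • X (t k)) =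
        2 * (eLpNorm (fun x => harmonizableKernel α (H τ) τ x -
        ∑ k, a k * harmonizableKernel α (H (t k)) (t k) x) (ENNReal.ofReal α)
          (volume.restrict (Ioi 0))).toReal := by
    intro n τ t a hτ ht
    have hmeas : ∀ k, Measurable ((-a k) • harmonizableKernel α (H (t k)) (t k)) := fun k =>
      (measurable_harmonizableKernel _ _ _).const_smul _
    have h1 := (hX τ hτ).isAEStochIntegral.add hM hα.le (measurable_harmonizableKernel _ _ _)
      (by
        rw [Finset.sum_fn]
        exact Finset.measurable_fun_sum _ fun k _ => hmeas k)
      (IsAEStochIntegral.sum hM hα.le Finset.univ hmeas fun k =>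
        ((hX (t k) (ht k)).isAEStochIntegral.const_smul hM (-a k)))
    have h2 : X τ + ∑ k, (-a k) • X (t k) = X τ - ∑ k, a k • X (t k) := by
      simp [sub_eq_add_neg]
    have h3 : harmonizableKernel α (H τ) τ +
        ∑ k, (-a k) • harmonizableKernel α (H (t k)) (t k) =
        fun x => harmonizableKernel α (H τ) τ x -
        ∑ k, a k * harmonizableKernel α (H (t k)) (t k) x := by
      ext x
      simp [sub_eq_add_neg]
    rw [h2, h3] at h1
    exact h1.stableNorm_eq hM hα.le ((measurable_harmonizableKernel _ _ _).sub
      (Finset.measurable_fun_sum _ fun k _ => (measurable_harmonizableKernel _ _ _).const_mul _))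
  have hlow : ∀ n : ℕ, ∃ c : ℝ, 0 < c ∧ ∀ (τ r : ℝ) (t a : Fin n → ℝ), 0 < r → r ≤ τ →
      (∀ k, 0 ≤ t k) → (∀ k, t k ≤ τ - r) →
      c * r ^ H τ ≤ stableNorm α P (X τ - ∑ k, a k • X (t k)) := by
    intro n
    obtain ⟨c, hc, hlow⟩ := exists_mul_rpow_le_eLpNorm_kernel hα hHinf_pos.le hHsup_lt n
    refine ⟨c, hc, fun τ r t a hr hrτ ht htτ => ?_⟩
    obtain ⟨hfin, heq⟩ := hcomb n τ t a (hr.le.trans hrτ) ht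
    have := hlow (H τ) τ r (fun k => H (t k)) t a (hH τ (hr.le.trans hrτ))
      (fun k => hH _ (ht k)) hr hrτ htτ _ rfl hfin
    rw [heq]
    have h0 : 0 ≤ c * r ^ H τ := by positivity
    linarith
  obtain ⟨C, hC, hup⟩ := exists_eLpNorm_kernel_sub_le hα hHinf_pos hHsup_lt T
  have hlt : ∀ s ∈ Icc ε T, ∀ t ∈ Icc ε T, s < t → 0 < stableNorm α P (X t - X s) := by
    intro s hs t ht hst
    obtain ⟨c, hc, h⟩ := hlow 1
    have h1 := h t (t - s) (fun _ => s) (fun _ => 1) (sub_pos.2 hst) (by linarith [hpos s hs])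
      (fun _ => (hpos s hs).le) (fun _ => by linarith)
    have h2 : 0 < c * (t - s) ^ H t := mul_pos hc (Real.rpow_pos_of_pos (sub_pos.2 hst) _)
    simpa using h2.trans_le h1
  have hdiff : ∀ s ∈ Icc ε T, ∀ t ∈ Icc ε T, stableNorm α P (X t - X s) =
      2 * (eLpNorm (fun x => harmonizableKernel α (H t) t x - harmonizableKernel α (H s) s x)
        (ENNReal.ofReal α) (volume.restrict (Ioi 0))).toReal := by
    intro s hs t ht
    have := (hcomb 1 t (fun _ => s) (fun _ => 1) (hpos t ht).le fun _ => (hpos s hs).le).2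
    simpa using this
  refine ⟨fun t ht => ?_, ⟨1, one_pos, fun s hs t ht hst _ => ?_⟩, fun n => ?_⟩
  -- With no other times, `r` may be as large as `t` itself: only the singularity at `w = 0`
  -- competes.
  · obtain ⟨c, hc, h⟩ := hlow 0
    have h1 := h t t (fun _ => 0) (fun _ => 0) (hpos t ht) le_rfl (fun _ => le_rfl)
      (fun k => k.elim0)
    have h2 : 0 < c * t ^ H t := mul_pos hc (Real.rpow_pos_of_pos (hpos t ht) _)
    simpa using h2.trans_le h1
  · rcases hst.lt_or_gt with h | h
    · exact hlt s hs t ht h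
    · have h1 := hlt t ht s hs h
      rw [hdiff t ht s hs] at h1
      rw [hdiff s hs t ht]
      convert h1 using 3
      exact eLpNorm_sub_comm _ _ _ _
  · obtain ⟨c, hc, h⟩ := hlow (n + 1)
    refine ⟨c / (2 * (C * (1 + |K|))), by positivity, 1, one_pos, fun t ht htS hlen => ?_⟩
    set τ := t (Fin.last (n + 1))
    set s := t (Fin.last n).castSucc
    have hsτ : s < τ := ht (Fin.castSucc_lt_last _)
    have hr0 : 0 < τ - s := sub_pos.2 hsτ
    have hr1 : τ - s ≤ 1 := by
      have : t 0 ≤ s := ht.monotone (Fin.zero_le _)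
      linarith
    have hs0 := hpos s (htS _)
    have hτ0 := hpos τ (htS _)
    have hupper : stableNorm α P (X τ - X s) ≤ 2 * (C * (1 + |K|)) * (τ - s) ^ H τ := by
      have h1 := hup (H τ) (H s) s τ (hH _ hτ0.le) (hH _ hs0.le) hs0.le (htS _).2 hsτ
      have h2 := ENNReal.toReal_le_of_le_ofReal (by positivity) h1
      -- The choice `δ = 1` gives `τ - s ≤ 1`, so the power `γ`, which exceeds `H τ`, only helps.
      have h3 : |H τ - H s| ≤ |K| * (τ - s) ^ H τ := by
        refine (hHolder s τ hs0.le hτ0.le).trans ?_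
        rw [abs_of_pos hr0]
        refine mul_le_mul (le_abs_self K) ?_ (by positivity) (abs_nonneg K)
        exact Real.rpow_le_rpow_of_exponent_ge hr0 hr1 ((hH τ hτ0.le).2.trans hγ.le)
      have h4 : C * ((τ - s) ^ H τ + |H τ - H s|) ≤ C * ((τ - s) ^ H τ + |K| * (τ - s) ^ H τ) := by
        gcongr
      rw [hdiff s (htS _) τ (htS _)]
      linarith
    have hlower : c * (τ - s) ^ H τ ≤ stableDist α P (X τ)
        (Submodule.span ℝ (Set.range fun k : Fin (n + 1) => X (t k.castSucc))) := by
      refine le_ciInf fun η => ?_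
      obtain ⟨a, ha⟩ := (Submodule.mem_span_range_iff_exists_fun ℝ).1 η.2
      rw [← ha]
      refine h τ (τ - s) (fun k => t k.castSucc) a hr0 (by linarith)
        (fun k => (hpos _ (htS _)).le) fun k => ?_
      have : t k.castSucc ≤ s := ht.monotone (Fin.castSucc_le_castSucc_iff.2 (Fin.le_last k))
      linarith
    refine le_trans ?_ hlower
    rw [div_mul_eq_mul_div, div_le_iff₀ (by positivity)]
    calc c * stableNorm α P (X τ - X s) ≤ c * (2 * (C * (1 + |K|)) * (τ - s) ^ H τ) := by gcongr
      _ = _ := by ring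

end
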